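/- Fix an integer $k\ge 2$. A $k$-graph is a $k$-uniform hypergraph with finite vertex set; $e_J$ denotes the number of edges of a $k$-graph $J$, and $J\subseteq H$ means that $V(J)\subseteq V(H)$ and $E(J)\subseteq E(H)$. A copy of $G$ in $F$ is a subgraph of $F$ isomorphic to $G$. Let $G^{(k)}_{n,p}$ be the random $k$-graph on $n$ vertices in which each of the $\binom nk$ possible edges is present independently with probability $p$, and let $X_H=X_H(n,p)$ be the number of copies of $H$ in $G^{(k)}_{n,p}$. Put $\varphi(x)=(1+x)\log(1+x)-x$, with $\varphi(-1)=1$. **Theorem.** Let $G\subseteq H$ be $k$-graphs with $e_G\ge 1$ such that there is exactly one copy of $G$ in $H$. Let $p=p(n)\in[0,1]$ satisfy $p=o(1)$ and, as $n\to\infty$, $\mathbb E X_G=o(\mathbb E X_J)$ for every $J\subseteq H$ with $J\ne G$ and $e_J\ge 1$. Let $\varepsilon=\varepsilon(n)\in(0,1]$, and suppose that there is a function $\omega(n)\to\infty$ such that for all sufficiently large $n$ $$\varepsilon^2\,\mathbb E X_G\;\ge\;\mathbf 1_{\{\varepsilon<1\}}\;\omega(n)\,\bigl(1+\mathbf 1_{\{G\ne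 H,\;e_G\ge 2\}}\log(1/\varepsilon)\bigr).$$ Then, as $n\to\infty$, $$\log \mathbb P\bigl(X_H\le(1-\varepsilon)\,\mathbb E X_H\bigr)\;\sim\;-\varphi(-\varepsilon)\,\mathbb E X_G .$$ Here $a_n\sim b_n$ means $a_n-b_n=o(b_n)$ (so $a_n=b_n=0$ is allowed), and $a_n=o(b_n)$ means that for each $c>0$, $|a_n|\le c|b_n|$ for all large $n$. -/

import Mathlib

open Filter Topology Asymptotics MeasureTheory ProbabilityTheory

noncomputable section

namespace LowerTail

/-- `H` is a `k`-graph: a hypergraph with finite vertex set, all of whose edges have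
exactly `k` vertices. -/
def IsKGraph {α : Type*} (k : ℕ) (H : Hypergraph α) : Prop :=
  H.vertexSet.Finite ∧ ∀ e ∈ H.edgeSet, e.ncard = k

/-- `J ⊆ H`: `J` is a (not necessarily induced or spanning) subgraph of `H`. -/
def IsSubgraph {α : Type*} (J H : Hypergraph α) : Prop :=
  J.vertexSet ⊆ H.vertexSet ∧ J.edgeSet ⊆ H.edgeSet

/-- Isomorphism: a bijection of the vertex sets under which edges correspond to edges. -/
def IsIsomorphic {α β : Type*} (G : Hypergraph α) (H : Hypergraph β) : Prop :=
  ∃ f : G.vertexSet ≃ H.vertexSet, ∀ s : Set G.vertexSet,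
    (Subtype.val '' s ∈ G.edgeSet ↔ Subtype.val '' (f '' s) ∈ H.edgeSet)

/-- The copies of `G` in `F`, i.e. the subgraphs of `F` that are isomorphic to `G`. -/
def copies {α β : Type*} (G : Hypergraph α) (F : Hypergraph β) : Set (Hypergraph β) :=
  {C | IsSubgraph C F ∧ IsIsomorphic G C}

/-- The hypergraph on the vertex set `{0, …, n - 1}` with edge set `S`. -/
def ofEdges {n : ℕ} (S : Set (Set (Fin n))) : Hypergraph (Fin n) where
  vertexSet := Set.univ
  edgeSet := S
  subset_vertexSet_of_mem_edgeSet' := fun _ _ => Set.subset_univ _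

/-- The law of the edge set of the binomial random `k`-graph `G^{(k)}_{n,p}`: each `k`-element
subset of the vertex set is included independently with probability `p`. -/
def edgeLaw (k n : ℕ) (p : unitInterval) : Measure (Set (Set (Fin n))) :=
  setBernoulli {e : Set (Fin n) | e.ncard = k} p

/-- `X_H`, the number of copies of `H`, as a function of the edge set of the host. -/
def X {α : Type*} (H : Hypergraph α) (n : ℕ) (S : Set (Set (Fin n))) : ℝ :=
  ((copies H (ofEdges S)).ncard : ℝ)

/-- `E X_H` in `G^{(k)}_{n,p}`. -/
def EX {α : Type*} (k : ℕ) (H : Hypergraph α) (n : ℕ) (p : unitInterval) : ℝ :=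
  ∫ S, X H n S ∂(edgeLaw k n p)

/-- `P(X_H ≤ (1 - ε) E X_H)` in `G^{(k)}_{n,p}`. -/
def lowerTail {α : Type*} (k : ℕ) (H : Hypergraph α) (n : ℕ) (p : unitInterval) (ε : ℝ) : ℝ :=
  (edgeLaw k n p).real {S | X H n S ≤ (1 - ε) * EX k H n p}

/-- `φ(x) = (1 + x) log (1 + x) - x`; here `φ(-1) = 1` since `0 * log 0 = 0`. -/
def phi (x : ℝ) : ℝ := (1 + x) * Real.log (1 + x) - x

open Classical in
/-- The indicator of a proposition. -/
def ind (P : Prop) : ℝ := if P then 1 else 0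

end LowerTail

end

/-!
The upper bound is Janson's inequality for the copies of `H`. Its exponent is
`φ(-ε) (E X_H)² / Λ`, where `Λ` sums the joint probabilities of the pairs of copies of `H` sharing
an edge. Sort these pairs by the subgraph `J ⊆ H` in which they intersect: double counting, and the
symmetry of the complete hypergraph, show that `J` contributes at most
`c_J² (E X_H)² / E X_J`, with `c_J` the number of copies of `J` in `H` (`corr_le`). As `G` has a
single copy in `H` and every other `E X_J` is much larger than `E X_G`, one gets
`Λ ≤ (1 + o(1)) (E X_H)² / E X_G` (`eventually_corr_le`).

For the lower bound, let `μ = E X_G`. If `ε` is close to `1`, it is enough that no copy of `G` is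
present, which by Harris' inequality has probability at least `exp (-(1 + o(1)) μ)`
(`exp_le_prob_count_eq_zero`). Otherwise, change the measure by a density proportional to
`exp (-t X_G)`, where `exp (-t) = 1 - (1 + γ) ε` with a small constant `γ`. Harris' inequality from
below and Janson's inequality from above pin down the Laplace transform,
`log E exp (-t X_G) = -(1 - exp (-t)) μ + o(t² μ)`, so that under the tilted measure `X_G` is
concentrated around `exp (-t) μ` in a window of width `γ ε μ`. Undoing the change of measure costs
`exp (-(1 + O(γ) + o(1)) φ(-ε) μ)`, and it remains to see that the tilted probability of
`X_H ≤ (1 - ε) E X_H` is not too small (`exp_le_prob_of_tilted`).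

* For `G = H` this is the concentration of `X_G` itself (`tilted_lower_tail_self`).
* If `G` is a single edge, the tilted measure is a binomial random hypergraph with a smaller edge
  probability, and Chebyshev's inequality applies (`tilted_lower_tail_chebyshev`).
* In the remaining case, the presence of a copy of `H` forces a copy of `G`, which costs a factor
  `exp (-t)`, and influences few other copies of `G`. So the tilted mean of `X_H` is at most about
  `(1 - ε - γ ε) E X_H`, and Markov's inequality gives tilted probability at least `γ ε / 2`
  (`tilted_lower_tail_markov`). This loss of a factor `ε` is what the logarithmic term in the
  hypothesis on `ε` pays for.
-/

set_option linter.unusedSectionVars false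

noncomputable section

namespace LowerTail

/-! ### Random subsets of a finite set with independent elements -/

section RandomSubset

variable {ι : Type*} [Fintype ι] [DecidableEq ι] {q : ι → ℝ} {f g : Finset ι → ℝ}

/-- The probability that the random subset of `ι` containing each `i` independently with
probability `q i` equals `S`. -/
def weight (q : ι → ℝ) (S : Finset ι) : ℝ := ∏ i, if i ∈ S then q i else 1 - q i

/-- Expectation with respect to `weight q`. -/
def expect (q : ι → ℝ) (f : Finset ι → ℝ) : ℝ := ∑ S, weight q S * f S

/-- The indicator of the event that the random subset contains `A`. -/
def incl (A S : Finset ι) : ℝ := if A ⊆ S then 1 else 0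

lemma incl_nonneg (A S : Finset ι) : 0 ≤ incl A S := by unfold incl; split_ifs <;> simp

lemma incl_le_one (A S : Finset ι) : incl A S ≤ 1 := by unfold incl; split_ifs <;> simp

lemma incl_mono (A : Finset ι) : Monotone (incl A) := by
  intro S T h
  unfold incl
  split_ifs with h1 h2
  · exact le_rfl
  · exact absurd (h1.trans h) h2
  · exact zero_le_one
  · exact le_rfl

lemma incl_mul_incl (A B S : Finset ι) : incl A S * incl B S = incl (A ∪ B) S := by
  unfold incl
  by_cases hA : A ⊆ S <;> by_cases hB : B ⊆ S <;> simp [hA, hB, Finset.union_subset_iff]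

lemma incl_union_of_disjoint {A B : Finset ι} (h : Disjoint A B) (S : Finset ι) :
    incl B (S ∪ A) = incl B S := by
  unfold incl
  have : B ⊆ S ∪ A ↔ B ⊆ S :=
    ⟨fun hB => (h.symm).left_le_of_le_sup_right hB, fun hB => hB.trans Finset.subset_union_left⟩
  simp [this]

lemma weight_nonneg (hq : ∀ i, q i ∈ Set.Icc (0 : ℝ) 1) (S : Finset ι) : 0 ≤ weight q S := by
  refine Finset.prod_nonneg fun i _ => ?_
  split_ifs
  · exact (hq i).1
  · linarith [(hq i).2]

lemma weight_mul_weight (S T : Finset ι) :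
    weight q S * weight q T = weight q (S ∩ T) * weight q (S ∪ T) := by
  simp only [weight, ← Finset.prod_mul_distrib]
  refine Finset.prod_congr rfl fun i _ => ?_
  by_cases h1 : i ∈ S <;> by_cases h2 : i ∈ T <;> simp [h1, h2, mul_comm]

lemma weight_eq_prod_mul_prod (S : Finset ι) :
    weight q S = (∏ i ∈ S, q i) * ∏ i ∈ Sᶜ, (1 - q i) := by
  unfold weight
  rw [← Finset.prod_mul_prod_compl S]
  congr 1
  · exact Finset.prod_congr rfl fun i hi => by simp [hi]
  · exact Finset.prod_congr rfl fun i hi => by simp [Finset.mem_compl.1 hi]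

lemma sum_weight : ∑ S, weight q S = 1 := by
  simp only [weight_eq_prod_mul_prod, ← Fintype.prod_add]
  simp

lemma expect_const (c : ℝ) : expect q (fun _ => c) = c := by
  rw [expect, ← Finset.sum_mul, sum_weight, one_mul]

lemma expect_add : expect q (fun S => f S + g S) = expect q f + expect q g := by
  simp [expect, mul_add, Finset.sum_add_distrib]

lemma expect_sub : expect q (fun S => f S - g S) = expect q f - expect q g := by
  simp [expect, mul_sub, Finset.sum_sub_distrib]

lemma expect_const_mul (c : ℝ) : expect q (fun S => c * f S) = c * expect q f := by
  simp only [expect, Finset.mul_sum]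
  exact Finset.sum_congr rfl fun S _ => by ring

lemma expect_sum {κ : Type*} (s : Finset κ) (F : κ → Finset ι → ℝ) :
    expect q (fun S => ∑ a ∈ s, F a S) = ∑ a ∈ s, expect q (F a) := by
  simp only [expect, Finset.mul_sum]
  exact Finset.sum_comm

lemma expect_mono (hq : ∀ i, q i ∈ Set.Icc (0 : ℝ) 1) (h : ∀ S, f S ≤ g S) :
    expect q f ≤ expect q g :=
  Finset.sum_le_sum fun S _ => mul_le_mul_of_nonneg_left (h S) (weight_nonneg hq S)

lemma expect_nonneg (hq : ∀ i, q i ∈ Set.Icc (0 : ℝ) 1) (h : ∀ S, 0 ≤ f S) : 0 ≤ expect q f :=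
  Finset.sum_nonneg fun S _ => mul_nonneg (weight_nonneg hq S) (h S)

lemma expect_exp_pos (hq : ∀ i, q i ∈ Set.Icc (0 : ℝ) 1) : 0 < expect q fun S => Real.exp (f S) := by
  have hne : (Finset.univ : Finset (Finset ι)).Nonempty := ⟨∅, Finset.mem_univ _⟩
  obtain ⟨S₀, -, hS₀⟩ := Finset.exists_min_image Finset.univ f hne
  calc 0 < Real.exp (f S₀) := Real.exp_pos _
    _ = expect q fun _ => Real.exp (f S₀) := (expect_const _).symm
    _ ≤ _ := expect_mono hq fun S => Real.exp_le_exp.2 (hS₀ S (Finset.mem_univ S))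

/-- Harris' inequality for two decreasing functions. -/
lemma expect_mul_expect_le (hq : ∀ i, q i ∈ Set.Icc (0 : ℝ) 1) (hf : Antitone f) (hg : Antitone g)
    (hf0 : ∀ S, 0 ≤ f S) (hg0 : ∀ S, 0 ≤ g S) :
    expect q f * expect q g ≤ expect q fun S => f S * g S := by
  have h := fkg (α := (Finset ι)ᵒᵈ) (β := ℝ) (fun S => f S.ofDual) (fun S => g S.ofDual)
    (fun S => weight q S.ofDual)
    (fun S => weight_nonneg hq _) (fun S => hf0 _) (fun S => hg0 _)
    (fun S T h => hf h) (fun S T h => hg h)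
    (fun S T => by
      have := (weight_mul_weight (q := q) S.ofDual T.ofDual).le
      rw [mul_comm (weight q (S.ofDual ∩ T.ofDual))] at this
      exact this)
  have h1 : ∑ a : (Finset ι)ᵒᵈ, weight q a.ofDual = 1 := sum_weight (q := q)
  rw [h1, one_mul] at h
  exact h

/-- Conditioning on `i` being present amounts to adding `i`. -/
lemma expect_mem (i : ι) (f : Finset ι → ℝ) :
    expect q (fun S => (if i ∈ S then 1 else 0) * f S) =
      q i * expect q (fun S => f (insert i S)) := by
  set R : Finset ι → ℝ := fun S => ∏ j ∈ Finset.univ.erase i, if j ∈ S then q j else 1 - q j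
    with hR
  have hw : ∀ S, weight q S = (if i ∈ S then q i else 1 - q i) * R S := fun S =>
    (Finset.mul_prod_erase _ _ (Finset.mem_univ i)).symm
  have hRi : ∀ S, R (insert i S) = R S := fun S => by
    refine Finset.prod_congr rfl fun j hj => ?_
    simp [Finset.mem_insert, Finset.ne_of_mem_erase hj]
  have hsplit : ∀ F : Finset ι → ℝ, ∑ S, F S =
      ∑ S with i ∈ S, F S + ∑ S with i ∉ S, F S := fun F =>
    (Finset.sum_filter_add_sum_filter_not _ _ _).symm
  have hbij : ∑ S with i ∉ S, (1 - q i) * R S * f (insert i S) =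
      ∑ S with i ∈ S, (1 - q i) * R S * f S := by
    refine Finset.sum_nbij' (fun S => insert i S) (fun S => S.erase i) ?_ ?_ ?_ ?_ ?_
    · intro S _; simp
    · intro S _; simp
    · intro S hS; simp only [Finset.mem_filter] at hS; exact Finset.erase_insert hS.2
    · intro S hS; simp only [Finset.mem_filter] at hS; exact Finset.insert_erase hS.2
    · intro S _; rw [hRi]
  unfold expect
  rw [hsplit, hsplit fun S => weight q S * f (insert i S)]
  have e1 : ∑ S with i ∉ S, weight q S * ((if i ∈ S then 1 else 0) * f S) = 0 :=
    Finset.sum_eq_zero fun S hS => by simp [(Finset.mem_filter.1 hS).2]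
  have e2 : ∑ S with i ∉ S, weight q S * f (insert i S) =
      ∑ S with i ∉ S, (1 - q i) * R S * f (insert i S) :=
    Finset.sum_congr rfl fun S hS => by rw [hw]; simp [(Finset.mem_filter.1 hS).2]
  rw [e1, e2, hbij, add_zero, ← Finset.sum_add_distrib, Finset.mul_sum]
  refine Finset.sum_congr rfl fun S hS => ?_
  have hi := (Finset.mem_filter.1 hS).2
  rw [hw, Finset.insert_eq_of_mem hi]
  simp only [hi, if_true]
  ring

/-- Conditioning on `A` being present amounts to adding `A`. -/
lemma expect_incl_mul (A : Finset ι) (f : Finset ι → ℝ) :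
    expect q (fun S => incl A S * f S) = (∏ i ∈ A, q i) * expect q (fun S => f (S ∪ A)) := by
  induction A using Finset.induction_on generalizing f with
  | empty => simp [incl]
  | insert a A ha ih =>
    have h1 : ∀ S, incl (insert a A) S * f S = (if a ∈ S then 1 else 0) * (incl A S * f S) := by
      intro S
      unfold incl
      by_cases h1 : a ∈ S <;> by_cases h2 : A ⊆ S <;> simp [h1, h2, Finset.insert_subset_iff]
    simp only [h1]
    rw [expect_mem, Finset.prod_insert ha, mul_assoc]
    congr 1
    have h2 : ∀ S, incl A (insert a S) = incl A S := by
      intro S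
      simp only [incl, Finset.subset_insert_iff_of_notMem ha]
    simp only [h2]
    rw [ih fun S => f (insert a S)]
    simp only [Finset.union_insert]

lemma expect_incl (A : Finset ι) : expect q (incl A) = ∏ i ∈ A, q i := by
  have := expect_incl_mul (q := q) A (fun _ => 1)
  simpa [expect_const] using this

/-- Jensen's inequality for the exponential. -/
lemma exp_expect_le (hq : ∀ i, q i ∈ Set.Icc (0 : ℝ) 1) (f : Finset ι → ℝ) :
    Real.exp (expect q f) ≤ expect q fun S => Real.exp (f S) := by
  set m := expect q f
  have h : ∀ S, Real.exp m * (f S - m) + Real.exp m ≤ Real.exp (f S) := by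
    intro S
    have := Real.add_one_le_exp (f S - m)
    calc Real.exp m * (f S - m) + Real.exp m = Real.exp m * ((f S - m) + 1) := by ring
      _ ≤ Real.exp m * Real.exp (f S - m) := mul_le_mul_of_nonneg_left this (Real.exp_pos _).le
      _ = Real.exp (f S) := by rw [← Real.exp_add]; ring_nf
  have h2 := expect_mono hq h
  rw [expect_add, expect_const, expect_const_mul, expect_sub, expect_const] at h2
  linarith

end RandomSubset

/-! ### Counts of contained sets: the Laplace transform -/

section Count

variable {ι κ : Type*} [Fintype ι] [DecidableEq ι] {q : ι → ℝ}

/-- The number of members of the family `(A a)`, `a ∈ s`, contained in `S`. -/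
def count (s : Finset κ) (A : κ → Finset ι) (S : Finset ι) : ℝ := ∑ a ∈ s, incl (A a) S

/-- The probability that the random subset contains `A`. -/
def pr (q : ι → ℝ) (A : Finset ι) : ℝ := ∏ i ∈ A, q i

/-- The expected value of `count s A`. -/
def mean (q : ι → ℝ) (s : Finset κ) (A : κ → Finset ι) : ℝ := ∑ a ∈ s, pr q (A a)

/-- The sum of the joint probabilities over the ordered pairs of intersecting members of a family,
diagonal pairs included. -/
def corr (q : ι → ℝ) (s : Finset κ) (A : κ → Finset ι) : ℝ :=
  ∑ a ∈ s, ∑ b ∈ s with ¬ Disjoint (A a) (A b), pr q (A a ∪ A b)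

variable {s : Finset κ} {A : κ → Finset ι}

lemma count_nonneg (S : Finset ι) : 0 ≤ count s A S := Finset.sum_nonneg fun _ _ => incl_nonneg _ _

lemma count_mono : Monotone (count s A) := fun _ _ h =>
  Finset.sum_le_sum fun _ _ => incl_mono _ h

lemma expect_count : expect q (count s A) = mean q s A := by
  unfold count mean pr
  rw [expect_sum]
  simp only [expect_incl]

lemma pr_nonneg (hq : ∀ i, q i ∈ Set.Icc (0 : ℝ) 1) (B : Finset ι) : 0 ≤ pr q B :=
  Finset.prod_nonneg fun i _ => (hq i).1

lemma mean_nonneg (hq : ∀ i, q i ∈ Set.Icc (0 : ℝ) 1) : 0 ≤ mean q s A :=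
  Finset.sum_nonneg fun _ _ => pr_nonneg hq _

lemma mean_le_corr (hq : ∀ i, q i ∈ Set.Icc (0 : ℝ) 1) (hA : ∀ a ∈ s, (A a).Nonempty) :
    mean q s A ≤ corr q s A := by
  refine Finset.sum_le_sum fun a ha => ?_
  have h : a ∈ s.filter fun b => ¬ Disjoint (A a) (A b) := by
    simp [ha, (hA a ha).ne_empty]
  calc pr q (A a) = pr q (A a ∪ A a) := by rw [Finset.union_idempotent]
    _ ≤ _ := Finset.single_le_sum (f := fun b => pr q (A a ∪ A b))
      (fun b _ => pr_nonneg hq _) h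

lemma antitone_exp_neg_count {t : ℝ} (ht : 0 ≤ t) (s : Finset κ) (A : κ → Finset ι) :
    Antitone fun S => Real.exp (-(t * count s A S)) := fun _ _ h =>
  Real.exp_le_exp.2 (neg_le_neg (mul_le_mul_of_nonneg_left (count_mono h) ht))

/-- Harris' inequality for the generating function of the count. With `a = 1` the left-hand side is
a lower bound for the probability that the count vanishes. -/
lemma prod_one_sub_le_expect (hq : ∀ i, q i ∈ Set.Icc (0 : ℝ) 1) {a : ℝ} (ha : a ∈ Set.Icc (0 : ℝ) 1)
    (s : Finset κ) (A : κ → Finset ι) :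
    ∏ b ∈ s, (1 - a * pr q (A b)) ≤ expect q fun S => ∏ b ∈ s, (1 - a * incl (A b) S) := by
  classical
  have hnn : ∀ b S, 0 ≤ 1 - a * incl (A b) S := fun b S => by
    nlinarith [incl_nonneg (A b) S, incl_le_one (A b) S, ha.1, ha.2]
  have hanti : ∀ b, Antitone fun S => 1 - a * incl (A b) S := fun b S T h => by
    have := mul_le_mul_of_nonneg_left (incl_mono (A b) h) ha.1
    simp only
    linarith
  induction s using Finset.induction_on with
  | empty => simp [expect_const]
  | insert c s hc ih =>
    simp only [Finset.prod_insert hc]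
    have h1 : expect q (fun S => 1 - a * incl (A c) S) = 1 - a * pr q (A c) := by
      rw [expect_sub, expect_const, expect_const_mul, expect_incl, pr]
    have h2 : 0 ≤ 1 - a * pr q (A c) := by
      rw [← h1]; exact expect_nonneg hq (hnn c)
    calc _ ≤ (1 - a * pr q (A c)) * expect q fun S => ∏ b ∈ s, (1 - a * incl (A b) S) :=
          mul_le_mul_of_nonneg_left ih h2
      _ = (expect q fun S => 1 - a * incl (A c) S) *
          expect q fun S => ∏ b ∈ s, (1 - a * incl (A b) S) := by rw [h1]
      _ ≤ _ := expect_mul_expect_le hq (hanti c)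
          (fun S T h => Finset.prod_le_prod (fun b _ => hnn b T) fun b _ => hanti b h)
          (hnn c) fun S => Finset.prod_nonneg fun b _ => hnn b S

/-- Split of the count after `B` has been added: members meeting `B` and members disjoint from it. -/
lemma count_union (B S : Finset ι) :
    count s A (S ∪ B) = count (s.filter fun b => ¬ Disjoint B (A b)) A (S ∪ B) +
      count (s.filter fun b => Disjoint B (A b)) A S := by
  unfold count
  rw [← Finset.sum_filter_add_sum_filter_not s (fun b => ¬ Disjoint B (A b))]
  congr 1
  simp only [not_not]
  exact Finset.sum_congr rfl fun b hb => incl_union_of_disjoint (Finset.mem_filter.1 hb).2 S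

lemma count_eq_filter_add (B S : Finset ι) :
    count s A S = count (s.filter fun b => ¬ Disjoint B (A b)) A S +
      count (s.filter fun b => Disjoint B (A b)) A S := by
  unfold count
  rw [← Finset.sum_filter_add_sum_filter_not s (fun b => ¬ Disjoint B (A b))]
  simp only [not_not]

/-- The key step of Janson's inequality: `E (X e^{-tX}) ≥ μ e^{-tΛ/μ} E e^{-tX}`, where `Λ` is
`corr`. -/
lemma mean_mul_exp_le (hq : ∀ i, q i ∈ Set.Icc (0 : ℝ) 1) {t : ℝ} (ht : 0 ≤ t)
    (hμ : 0 < mean q s A) :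
    mean q s A * Real.exp (-(t * (corr q s A / mean q s A))) *
        (expect q fun S => Real.exp (-(t * count s A S))) ≤
      expect q fun S => count s A S * Real.exp (-(t * count s A S)) := by
  set μ := mean q s A with hμdef
  set L := expect q fun S => Real.exp (-(t * count s A S)) with hL
  have hLpos : 0 < L := expect_exp_pos hq
  -- the expected number of members meeting `A a`, given that `A a` is present
  set y : κ → ℝ := fun a =>
    expect q fun S => count (s.filter fun b => ¬ Disjoint (A a) (A b)) A (S ∪ A a) with hy
  have hcorr : ∑ a ∈ s, pr q (A a) * y a = corr q s A := by
    refine Finset.sum_congr rfl fun a _ => ?_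
    rw [hy, pr, ← expect_incl_mul (A a)]
    simp only [count, Finset.mul_sum, incl_mul_incl]
    rw [expect_sum]
    simp only [expect_incl, pr]
  have hterm : ∀ a ∈ s, pr q (A a) * Real.exp (-(t * y a)) * L ≤
      expect q fun S => incl (A a) S * Real.exp (-(t * count s A S)) := by
    intro a _
    rw [expect_incl_mul (A a) fun S => Real.exp (-(t * count s A S)), mul_assoc]
    refine mul_le_mul_of_nonneg_left ?_ (pr_nonneg hq _)
    have h1 : ∀ S, Real.exp (-(t * count s A (S ∪ A a))) =
        Real.exp (-(t * count (s.filter fun b => ¬ Disjoint (A a) (A b)) A (S ∪ A a))) *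
        Real.exp (-(t * count (s.filter fun b => Disjoint (A a) (A b)) A S)) := by
      intro S
      rw [← Real.exp_add, count_union (A a) S]
      ring_nf
    simp only [h1]
    refine le_trans ?_ (expect_mul_expect_le hq ?_ ?_ ?_ ?_)
    · refine mul_le_mul ?_ ?_ hLpos.le (expect_exp_pos hq).le
      · refine le_trans (le_of_eq ?_) (exp_expect_le hq _)
        congr 1
        rw [hy]
        simp only [← neg_mul]
        rw [expect_const_mul]
      · refine expect_mono hq fun S => Real.exp_le_exp.2 (neg_le_neg ?_)
        refine mul_le_mul_of_nonneg_left ?_ ht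
        rw [count_eq_filter_add (s := s) (A a) S]
        linarith [count_nonneg (s := s.filter fun b => ¬ Disjoint (A a) (A b)) (A := A) S]
    · intro S T h
      exact antitone_exp_neg_count ht _ A (Finset.union_subset_union_left h)
    · exact antitone_exp_neg_count ht _ A
    · exact fun S => (Real.exp_pos _).le
    · exact fun S => (Real.exp_pos _).le
  have hsum : expect q (fun S => count s A S * Real.exp (-(t * count s A S))) =
      ∑ a ∈ s, expect q fun S => incl (A a) S * Real.exp (-(t * count s A S)) := by
    rw [← expect_sum]
    refine congrArg _ (funext fun S => ?_)
    rw [count, Finset.sum_mul]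
  rw [hsum]
  refine le_trans ?_ (Finset.sum_le_sum hterm)
  rw [← Finset.sum_mul]
  refine mul_le_mul_of_nonneg_right ?_ hLpos.le
  -- Jensen's inequality for the weights `pr q (A a)`, through the tangent at `corr / mean`
  set m := corr q s A / μ with hm
  have htan : ∀ a ∈ s, pr q (A a) * (Real.exp (-(t * m)) * (1 - t * (y a - m))) ≤
      pr q (A a) * Real.exp (-(t * y a)) := by
    intro a _
    refine mul_le_mul_of_nonneg_left ?_ (pr_nonneg hq _)
    have := Real.add_one_le_exp (-(t * (y a - m)))
    calc _ ≤ Real.exp (-(t * m)) * Real.exp (-(t * (y a - m))) :=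
          mul_le_mul_of_nonneg_left (by linarith) (Real.exp_pos _).le
      _ = _ := by rw [← Real.exp_add]; ring_nf
  refine le_trans (le_of_eq ?_) (Finset.sum_le_sum htan)
  have h3 : ∑ a ∈ s, pr q (A a) * (Real.exp (-(t * m)) * (1 - t * (y a - m))) =
      Real.exp (-(t * m)) * ((1 + t * m) * ∑ a ∈ s, pr q (A a) - t * ∑ a ∈ s, pr q (A a) * y a) := by
    rw [Finset.mul_sum, Finset.mul_sum, ← Finset.sum_sub_distrib, Finset.mul_sum]
    exact Finset.sum_congr rfl fun a _ => by ring
  rw [h3, hcorr]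
  have h4 : ∑ a ∈ s, pr q (A a) = μ := rfl
  have h5 : corr q s A = m * μ := by rw [hm]; field_simp
  rw [h4, h5]
  ring

/-- Janson's bound for the Laplace transform of the count. -/
lemma expect_exp_neg_le (hq : ∀ i, q i ∈ Set.Icc (0 : ℝ) 1) {t : ℝ} (ht : 0 ≤ t)
    (hμ : 0 < mean q s A) (hΛ : 0 < corr q s A) :
    (expect q fun S => Real.exp (-(t * count s A S))) ≤
      Real.exp (-(mean q s A ^ 2 / corr q s A *
        (1 - Real.exp (-(t * (corr q s A / mean q s A)))))) := by
  set μ := mean q s A with hμdef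
  set Λ := corr q s A with hΛdef
  set L : ℝ → ℝ := fun t => expect q fun S => Real.exp (-(t * count s A S)) with hL
  have hLpos : ∀ t, 0 < L t := fun t => expect_exp_pos hq
  have hLd : ∀ t, HasDerivAt L
      (-(expect q fun S => count s A S * Real.exp (-(t * count s A S)))) t := by
    intro t
    have : HasDerivAt L (∑ S, weight q S * (Real.exp (-(t * count s A S)) * -(count s A S))) t := by
      refine HasDerivAt.fun_sum fun S _ => HasDerivAt.const_mul _ (HasDerivAt.exp ?_)
      exact (hasDerivAt_mul_const (count s A S)).neg
    refine this.congr_deriv ?_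
    rw [expect, ← Finset.sum_neg_distrib]
    exact Finset.sum_congr rfl fun S _ => by ring
  set F : ℝ → ℝ := fun t => Real.log (L t) + μ ^ 2 / Λ * (1 - Real.exp (-(t * (Λ / μ)))) with hF
  have hFd : ∀ t, HasDerivAt F
      (-(expect q fun S => count s A S * Real.exp (-(t * count s A S))) / L t +
        μ ^ 2 / Λ * (-(Real.exp (-(t * (Λ / μ))) * -(Λ / μ)))) t := by
    intro t
    refine ((hLd t).log (hLpos t).ne').add (HasDerivAt.const_mul _ (HasDerivAt.const_sub _ ?_))
    exact HasDerivAt.exp (hasDerivAt_mul_const (Λ / μ)).neg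
  have hanti : AntitoneOn F (Set.Ici 0) := by
    refine antitoneOn_of_hasDerivWithinAt_nonpos (convex_Ici 0)
      (fun t _ => (hFd t).continuousAt.continuousWithinAt)
      (fun t _ => (hFd t).hasDerivWithinAt) ?_
    intro t ht'
    rw [interior_Ici] at ht'
    have h := mean_mul_exp_le (s := s) (A := A) hq (le_of_lt ht') hμ
    have e1 : μ ^ 2 / Λ * (-(Real.exp (-(t * (Λ / μ))) * -(Λ / μ))) =
        μ * Real.exp (-(t * (Λ / μ))) := by
      field_simp
    rw [e1, neg_div]
    have := (le_div_iff₀ (hLpos t)).2 h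
    linarith
  have h0 : F 0 = 0 := by
    simp [hF, hL, expect_const]
  have h1 : F t ≤ 0 := by
    rw [← h0]; exact hanti Set.self_mem_Ici ht ht
  have h2 : Real.log (L t) ≤ -(μ ^ 2 / Λ * (1 - Real.exp (-(t * (Λ / μ))))) := by
    simp only [hF] at h1; linarith
  exact (Real.log_le_iff_le_exp (hLpos t)).1 h2

end Count

/-! ### Isomorphisms and copies -/

section Iso

variable {α β γ : Type*}

lemma IsSubgraph.refl (J : Hypergraph α) : IsSubgraph J J := ⟨subset_rfl, subset_rfl⟩

lemma IsSubgraph.trans {J K L : Hypergraph α} (h : IsSubgraph J K) (h' : IsSubgraph K L) :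
    IsSubgraph J L := ⟨h.1.trans h'.1, h.2.trans h'.2⟩

lemma IsSubgraph.image {J K : Hypergraph α} (h : IsSubgraph J K) (f : α → β) :
    IsSubgraph (J.image f) (K.image f) :=
  ⟨Set.image_mono h.1, Set.image_mono h.2⟩

lemma edge_subset {J : Hypergraph α} {e : Set α} (he : e ∈ J.edgeSet) : e ⊆ J.vertexSet :=
  J.subset_vertexSet_of_mem_edgeSet' he

lemma isIsomorphic_image (J : Hypergraph α) {f : α → β} (hf : Set.InjOn f J.vertexSet) :
    IsIsomorphic J (J.image f) := by
  refine ⟨Equiv.Set.imageOfInjOn f J.vertexSet hf, fun s => ?_⟩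
  have h : (Subtype.val '' (Equiv.Set.imageOfInjOn f J.vertexSet hf '' s) : Set β) =
      f '' (Subtype.val '' s) := by
    rw [Set.image_image, Set.image_image]; rfl
  suffices hs : Subtype.val '' s ∈ J.edgeSet ↔ f '' (Subtype.val '' s) ∈ (J.image f).edgeSet from
    hs.trans (iff_of_eq (congrArg (· ∈ (J.image f).edgeSet) h.symm))
  refine ⟨fun hs => ⟨_, hs, rfl⟩, ?_⟩
  rintro ⟨e, he, hes⟩
  have : e = Subtype.val '' s :=
    (hf.image_eq_image_iff (edge_subset he) (by rintro _ ⟨x, _, rfl⟩; exact x.2)).1 hes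
  rwa [← this]

lemma image_eq_of_equiv {J : Hypergraph α} {C : Hypergraph β} (F : J.vertexSet ≃ C.vertexSet)
    (hF : ∀ s : Set J.vertexSet,
      (Subtype.val '' s ∈ J.edgeSet ↔ Subtype.val '' (F '' s) ∈ C.edgeSet))
    {f : α → β} (hf : ∀ x : J.vertexSet, f x = F x) : J.image f = C := by
  have himg : ∀ s : Set J.vertexSet,
      f '' (Subtype.val '' s) = Subtype.val '' (F '' s) := by
    intro s
    rw [Set.image_image, Set.image_image]
    exact Set.image_congr fun x _ => hf x
  ext1
  · have := himg Set.univ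
    simpa using this
  · ext e
    constructor
    · rintro ⟨e', he', rfl⟩
      have h1 : e' = Subtype.val '' (Subtype.val ⁻¹' e' : Set J.vertexSet) := by
        rw [Subtype.image_preimage_coe, Set.inter_eq_right.2 (edge_subset he')]
      rw [h1, himg, ← hF, ← h1]
      exact he'
    · intro he
      have h1 : e = Subtype.val '' (F '' (F ⁻¹' (Subtype.val ⁻¹' e))) := by
        rw [Set.image_preimage_eq _ F.surjective, Subtype.image_preimage_coe,
          Set.inter_eq_right.2 (edge_subset he)]
      refine ⟨Subtype.val '' (F ⁻¹' (Subtype.val ⁻¹' e)), (hF _).2 (h1 ▸ he), ?_⟩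
      rw [himg, ← h1]

lemma IsIsomorphic.exists_image [Nonempty β] {J : Hypergraph α} {C : Hypergraph β}
    (h : IsIsomorphic J C) : ∃ f : α → β, Set.InjOn f J.vertexSet ∧ J.image f = C := by
  classical
  obtain ⟨F, hF⟩ := h
  set f : α → β := fun x =>
    if h : x ∈ J.vertexSet then (F ⟨x, h⟩ : β) else Classical.arbitrary β with hf
  have hfF : ∀ x : J.vertexSet, f x = F x := fun x => by simp [hf, x.2]
  refine ⟨f, fun x hx y hy hxy => ?_, image_eq_of_equiv F hF hfF⟩
  have h1 := hfF ⟨x, hx⟩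
  have h2 := hfF ⟨y, hy⟩
  simp only at h1 h2
  rw [h1, h2] at hxy
  exact congrArg Subtype.val (F.injective (Subtype.ext hxy))

/-- Isomorphic hypergraphs on the same finite set differ by a permutation of the whole set. -/
lemma IsIsomorphic.exists_perm [Finite β] {C D : Hypergraph β} (h : IsIsomorphic C D) :
    ∃ σ : Equiv.Perm β, C.image σ = D := by
  classical
  have := Fintype.ofFinite β
  obtain ⟨F, hF⟩ := h
  exact ⟨F.extendSubtype, image_eq_of_equiv F hF fun x => F.extendSubtype_apply_of_mem x x.2⟩

lemma IsIsomorphic.symm {J : Hypergraph α} {C : Hypergraph β} (h : IsIsomorphic J C) :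
    IsIsomorphic C J := by
  obtain ⟨F, hF⟩ := h
  refine ⟨F.symm, fun s => ?_⟩
  rw [hF (F.symm '' s), ← Set.image_comp F F.symm]
  simp

lemma IsIsomorphic.trans {J : Hypergraph α} {C : Hypergraph β} {D : Hypergraph γ}
    (h : IsIsomorphic J C) (h' : IsIsomorphic C D) : IsIsomorphic J D := by
  obtain ⟨F, hF⟩ := h
  obtain ⟨F', hF'⟩ := h'
  refine ⟨F.trans F', fun s => ?_⟩
  rw [hF, hF', Equiv.coe_trans, Set.image_comp]

lemma IsIsomorphic.refl (J : Hypergraph α) : IsIsomorphic J J :=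
  ⟨Equiv.refl _, fun s => by simp⟩

lemma isSubgraph_eq_of_image_eq {J K H : Hypergraph α} {f : α → β}
    (hf : Set.InjOn f H.vertexSet) (hJ : IsSubgraph J H) (hK : IsSubgraph K H)
    (h : J.image f = K.image f) : J = K := by
  have hV := congrArg Hypergraph.vertexSet h
  have hE := congrArg Hypergraph.edgeSet h
  simp only [Hypergraph.image_vertexSet, Hypergraph.image_edgeSet] at hV hE
  have hf2 : Set.InjOn (Set.image f) H.edgeSet := fun e he e' he' hee' =>
    (hf.image_eq_image_iff (edge_subset he) (edge_subset he')).1 hee'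
  ext1
  · exact (hf.image_eq_image_iff hJ.1 hK.1).1 hV
  · exact (hf2.image_eq_image_iff hJ.2 hK.2).1 hE

lemma IsSubgraph.exists_image_eq {H : Hypergraph α} {f : α → β} {D : Hypergraph β}
    (h : IsSubgraph D (H.image f)) : ∃ J, IsSubgraph J H ∧ J.image f = D := by
  refine ⟨⟨H.vertexSet ∩ f ⁻¹' D.vertexSet, {e ∈ H.edgeSet | f '' e ∈ D.edgeSet}, ?_⟩,
    ⟨Set.inter_subset_left, Set.sep_subset _ _⟩, ?_⟩
  · exact fun e he => Set.subset_inter (edge_subset he.1) (Set.image_subset_iff.1 (edge_subset he.2))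
  · ext1
    · simp only [Hypergraph.image_vertexSet]
      refine Set.Subset.antisymm (by rintro _ ⟨x, hx, rfl⟩; exact hx.2) fun y hy => ?_
      obtain ⟨x, hx, rfl⟩ := h.1 hy
      exact ⟨x, ⟨hx, hy⟩, rfl⟩
    · simp only [Hypergraph.image_edgeSet]
      refine Set.Subset.antisymm (by rintro _ ⟨x, hx, rfl⟩; exact hx.2) fun y hy => ?_
      obtain ⟨x, hx, rfl⟩ := h.2 hy
      exact ⟨x, ⟨hx, hy⟩, rfl⟩

lemma IsIsomorphic.ncard_edgeSet [Nonempty β] {J : Hypergraph α} {C : Hypergraph β}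
    (h : IsIsomorphic J C) : C.edgeSet.ncard = J.edgeSet.ncard := by
  obtain ⟨f, hf, rfl⟩ := h.exists_image
  refine Set.InjOn.ncard_image fun e he e' he' hee' => ?_
  exact (hf.image_eq_image_iff (edge_subset he) (edge_subset he')).1 hee'

lemma IsIsomorphic.ncard_of_mem [Nonempty β] {k : ℕ} {J : Hypergraph α} {C : Hypergraph β}
    (h : IsIsomorphic J C) (hJ : ∀ e ∈ J.edgeSet, e.ncard = k) : ∀ e ∈ C.edgeSet, e.ncard = k := by
  obtain ⟨f, hf, rfl⟩ := h.exists_image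
  rintro _ ⟨e, he, rfl⟩
  rw [Set.InjOn.ncard_image (hf.mono (edge_subset he)), hJ e he]

/-- A finite hypergraph has finitely many subgraphs. -/
lemma finite_subgraphs {H : Hypergraph α} (hV : H.vertexSet.Finite) :
    {J | IsSubgraph J H}.Finite := by
  have hE : H.edgeSet.Finite := hV.finite_subsets.subset fun e he => edge_subset he
  refine Set.Finite.of_finite_image (f := fun J => (J.vertexSet, J.edgeSet))
    ((hV.finite_subsets.prod hE.finite_subsets).subset ?_) ?_
  · rintro _ ⟨J, hJ, rfl⟩
    exact ⟨hJ.1, hJ.2⟩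
  · intro J _ K _ h
    simp only [Prod.mk.injEq] at h
    exact Hypergraph.ext h.1 h.2

end Iso

/-! ### Counting copies by symmetry -/

section Copies

open scoped Classical

variable {α β : Type*} [Finite β]

instance : Finite (Hypergraph β) :=
  Finite.of_injective (fun J : Hypergraph β => (J.vertexSet, J.edgeSet)) fun J K h => by
    simp only [Prod.mk.injEq] at h
    exact Hypergraph.ext h.1 h.2

/-- The copies of `J` in the complete hypergraph on `β`. -/
def allCopies (J : Hypergraph α) (β : Type*) [Finite β] : Finset (Hypergraph β) :=
  (Set.toFinite {C : Hypergraph β | IsIsomorphic J C}).toFinset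

@[simp] lemma mem_allCopies {J : Hypergraph α} {C : Hypergraph β} :
    C ∈ allCopies J β ↔ IsIsomorphic J C := by simp [allCopies]

/-- The edges of a hypergraph on a finite set, as a `Finset`. -/
def edges (C : Hypergraph β) : Finset (Set β) := (Set.toFinite C.edgeSet).toFinset

@[simp] lemma mem_edges {C : Hypergraph β} {e : Set β} : e ∈ edges C ↔ e ∈ C.edgeSet := by
  simp [edges]

@[simp] lemma coe_edges (C : Hypergraph β) : (edges C : Set (Set β)) = C.edgeSet := by
  simp [edges]

lemma card_edges (C : Hypergraph β) : (edges C).card = C.edgeSet.ncard := by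
  rw [← Set.ncard_coe_finset, coe_edges]

lemma card_edges_of_mem [Nonempty β] {J : Hypergraph α} {C : Hypergraph β}
    (h : C ∈ allCopies J β) : (edges C).card = J.edgeSet.ncard := by
  rw [card_edges, (mem_allCopies.1 h).ncard_edgeSet]

/-- The number of copies of `J` contained in a given copy of `H` is the number of copies of `J`
in `H`. -/
lemma card_filter_isSubgraph [Nonempty β] (J : Hypergraph α) {H : Hypergraph α} {C : Hypergraph β}
    (hC : C ∈ allCopies H β) :
    ((allCopies J β).filter fun D => IsSubgraph D C).card = (copies J H).ncard := by
  obtain ⟨f, hf, rfl⟩ := (mem_allCopies.1 hC).exists_image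
  have h : (((allCopies J β).filter fun D => IsSubgraph D (H.image f) : Finset _) :
      Set (Hypergraph β)) = (fun K => K.image f) '' copies J H := by
    ext D
    simp only [Finset.coe_filter, mem_allCopies, Set.mem_image]
    constructor
    · rintro ⟨h1, h2⟩
      obtain ⟨K, hK, rfl⟩ := h2.exists_image_eq
      exact ⟨K, ⟨hK, h1.trans (isIsomorphic_image K (hf.mono hK.1)).symm⟩, rfl⟩
    · rintro ⟨K, ⟨hK, hJK⟩, rfl⟩
      exact ⟨hJK.trans (isIsomorphic_image K (hf.mono hK.1)), hK.image f⟩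
  rw [← Set.ncard_coe_finset, h]
  exact Set.InjOn.ncard_image fun K hK L hL hKL => isSubgraph_eq_of_image_eq hf hK.1 hL.1 hKL

lemma isSubgraph_image_perm {D C : Hypergraph β} (σ : Equiv.Perm β) :
    IsSubgraph (D.image σ) (C.image σ) ↔ IsSubgraph D C := by
  refine ⟨fun h => ?_, fun h => h.image σ⟩
  have := h.image σ.symm
  have e : ∀ K : Hypergraph β, (K.image σ).image σ.symm = K := fun K => by
    ext1 <;> simp [Set.image_image]
  rwa [e, e] at this

/-- By symmetry, all copies of `J` lie in the same number of copies of `H`. -/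
lemma card_filter_supergraph_eq (H : Hypergraph α) {D D' : Hypergraph β} (h : IsIsomorphic D D') :
    ((allCopies H β).filter fun C => IsSubgraph D C).card =
      ((allCopies H β).filter fun C => IsSubgraph D' C).card := by
  obtain ⟨σ, rfl⟩ := h.exists_perm
  have e : ∀ K : Hypergraph β, (K.image σ).image σ.symm = K := fun K => by
    ext1 <;> simp [Set.image_image]
  have e' : ∀ K : Hypergraph β, (K.image σ.symm).image σ = K := fun K => by
    ext1 <;> simp [Set.image_image]
  refine Finset.card_nbij' (fun C => C.image σ) (fun C => C.image σ.symm) ?_ ?_ ?_ ?_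
  · intro C hC
    simp only [Finset.coe_filter, mem_allCopies, Set.mem_ofPred_eq] at hC ⊢
    exact ⟨hC.1.trans (isIsomorphic_image C σ.injective.injOn), (isSubgraph_image_perm σ).2 hC.2⟩
  · intro C hC
    simp only [Finset.coe_filter, mem_allCopies, Set.mem_ofPred_eq] at hC ⊢
    refine ⟨hC.1.trans (isIsomorphic_image C σ.symm.injective.injOn), ?_⟩
    rw [← isSubgraph_image_perm σ, e']
    exact hC.2
  · exact fun C _ => e C
  · exact fun C _ => e' C

/-- Double counting of the pairs `D ⊆ C` of copies of `J` and `H`. -/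
lemma card_allCopies_mul [Nonempty β] (H : Hypergraph α) {J : Hypergraph α} {D : Hypergraph β}
    (hD : D ∈ allCopies J β) :
    (allCopies J β).card * ((allCopies H β).filter fun C => IsSubgraph D C).card =
      (allCopies H β).card * (copies J H).ncard := by
  have h := Finset.sum_card_bipartiteAbove_eq_sum_card_bipartiteBelow
    (s := allCopies J β) (t := allCopies H β) (fun D C => IsSubgraph D C)
  simp only [Finset.bipartiteAbove, Finset.bipartiteBelow] at h
  rw [Finset.sum_const_nat fun D' hD' => card_filter_supergraph_eq H
      ((mem_allCopies.1 hD').symm.trans (mem_allCopies.1 hD)),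
    Finset.sum_const_nat fun C hC => card_filter_isSubgraph J hC] at h
  exact h

/-- A subgraph of a copy of `H` is a copy of a subgraph of `H`. -/
lemma exists_mem_allCopies [Nonempty β] {H : Hypergraph α} {C D : Hypergraph β}
    (hC : C ∈ allCopies H β) (hD : IsSubgraph D C) : ∃ J, IsSubgraph J H ∧ D ∈ allCopies J β := by
  obtain ⟨f, hf, rfl⟩ := (mem_allCopies.1 hC).exists_image
  obtain ⟨J, hJ, rfl⟩ := hD.exists_image_eq
  exact ⟨J, hJ, mem_allCopies.2 (isIsomorphic_image J (hf.mono hJ.1))⟩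

lemma allCopies_nonempty [Fintype β] {H : Hypergraph α} (hV : H.vertexSet.Finite)
    (hn : H.vertexSet.ncard ≤ Fintype.card β) : (allCopies H β).Nonempty := by
  have := hV.fintype
  have hc : Fintype.card H.vertexSet ≤ Fintype.card β := by
    rwa [← Nat.card_eq_fintype_card]
  obtain ⟨f⟩ := Function.Embedding.nonempty_of_card_le hc
  rcases isEmpty_or_nonempty β with hβ | hβ
  · have : IsEmpty H.vertexSet := Function.isEmpty f
    have h0 : H.vertexSet = ∅ := Set.isEmpty_coe_sort.1 this
    refine ⟨⟨∅, {e | e = ∅ ∧ (∅ : Set α) ∈ H.edgeSet}, fun e he => he.1.subset⟩, ?_⟩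
    rw [mem_allCopies]
    refine ⟨(Equiv.equivOfIsEmpty H.vertexSet (∅ : Set β)), fun s => ?_⟩
    have hs : s = ∅ := Set.eq_empty_of_isEmpty s
    simp [hs]
  · set g : α → β := fun x => if h : x ∈ H.vertexSet then f ⟨x, h⟩ else Classical.arbitrary β
    refine ⟨H.image g, mem_allCopies.2 (isIsomorphic_image H fun x hx y hy hxy => ?_)⟩
    simp only [g, dif_pos hx, dif_pos hy] at hxy
    exact congrArg Subtype.val (f.injective hxy)

end Copies

/-! ### Copies in the random hypergraph -/

section RandomHypergraph

open scoped Classical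

variable {α β : Type*} [Fintype β] {k : ℕ} {p : ℝ}

/-- The edge probabilities of the binomial random `k`-graph: all edges are `k`-element sets. -/
def edgeProb (k : ℕ) (p : ℝ) (e : Set β) : ℝ := if e.ncard = k then p else 0

lemma edgeProb_mem_Icc (hp : p ∈ Set.Icc (0 : ℝ) 1) (e : Set β) :
    edgeProb k p e ∈ Set.Icc (0 : ℝ) 1 := by
  unfold edgeProb
  split_ifs
  · exact hp
  · simp

/-- The mean number of copies of `J` in the random `k`-graph on `β`. -/
def meanCopies (k : ℕ) (p : ℝ) (J : Hypergraph α) (β : Type*) [Fintype β] : ℝ :=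
  mean (edgeProb k p) (allCopies J β) edges

lemma pr_eq_pow {B : Finset (Set β)} (hB : ∀ e ∈ B, e.ncard = k) :
    pr (edgeProb k p) B = p ^ B.card := by
  rw [pr, Finset.prod_congr rfl fun e he => ?_, Finset.prod_const]
  simp [edgeProb, hB e he]

lemma ncard_of_mem_edges [Nonempty β] {J : Hypergraph α} {C : Hypergraph β}
    (hJ : ∀ e ∈ J.edgeSet, e.ncard = k) (hC : C ∈ allCopies J β) : ∀ e ∈ edges C, e.ncard = k :=
  fun e he => (mem_allCopies.1 hC).ncard_of_mem hJ e (mem_edges.1 he)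

lemma pr_edges [Nonempty β] {J : Hypergraph α} {C : Hypergraph β}
    (hJ : ∀ e ∈ J.edgeSet, e.ncard = k) (hC : C ∈ allCopies J β) :
    pr (edgeProb k p) (edges C) = p ^ J.edgeSet.ncard := by
  rw [pr_eq_pow (ncard_of_mem_edges hJ hC), card_edges_of_mem hC]

lemma meanCopies_eq [Nonempty β] {J : Hypergraph α} (hJ : ∀ e ∈ J.edgeSet, e.ncard = k) :
    meanCopies k p J β = (allCopies J β).card * p ^ J.edgeSet.ncard := by
  rw [meanCopies, mean, Finset.sum_congr rfl fun C hC => pr_edges hJ hC, Finset.sum_const,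
    nsmul_eq_mul]

/-- The intersection of two hypergraphs. -/
def inter (C D : Hypergraph β) : Hypergraph β :=
  ⟨C.vertexSet ∩ D.vertexSet, C.edgeSet ∩ D.edgeSet,
    fun _ he => Set.subset_inter (edge_subset he.1) (edge_subset he.2)⟩

/-- Sorting the pairs of intersecting copies of `H` by the subgraph of `H` in which they intersect
bounds `corr`. The contribution of each subgraph is computed exactly by double counting. -/
lemma corr_le [Nonempty β] (hp : 0 < p) {H : Hypergraph α} (hH : IsKGraph k H)
    {T : Finset (Hypergraph α)} (hT : ∀ J, J ∈ T ↔ IsSubgraph J H ∧ 1 ≤ J.edgeSet.ncard) :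
    corr (edgeProb k p) (allCopies H β) edges ≤
      ∑ J ∈ T, ((copies J H).ncard : ℝ) ^ 2 *
        (meanCopies k p H β ^ 2 / meanCopies k p J β) := by
  set m := H.edgeSet.ncard with hm
  set I : Hypergraph β → Hypergraph β → ℝ := fun D C => if IsSubgraph D C then 1 else 0 with hI
  have hI0 : ∀ D C, 0 ≤ I D C := fun D C => by simp only [hI]; split_ifs <;> simp
  set W : Hypergraph α → ℝ := fun J => p ^ (2 * m) / p ^ J.edgeSet.ncard with hW
  have hW0 : ∀ J, 0 ≤ W J := fun J => by positivity
  have hnn : ∀ C C' J D, 0 ≤ I D C * I D C' * W J := fun C C' J D =>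
    mul_nonneg (mul_nonneg (hI0 _ _) (hI0 _ _)) (hW0 _)
  have hpair : ∀ C ∈ allCopies H β, ∀ C' ∈ allCopies H β, ¬ Disjoint (edges C) (edges C') →
      pr (edgeProb k p) (edges C ∪ edges C') ≤
        ∑ J ∈ T, ∑ D ∈ allCopies J β, I D C * I D C' * W J := by
    intro C hC C' hC' hd
    have h1 : IsSubgraph (inter C C') C := ⟨Set.inter_subset_left, Set.inter_subset_left⟩
    have h2 : IsSubgraph (inter C C') C' := ⟨Set.inter_subset_right, Set.inter_subset_right⟩
    obtain ⟨J, hJ, hDJ⟩ := exists_mem_allCopies hC h1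
    have hE : edges (inter C C') = edges C ∩ edges C' := by
      ext e; simp [inter]
    have hcard : (edges C ∩ edges C').card = J.edgeSet.ncard := by
      rw [← hE, card_edges_of_mem hDJ]
    have hJT : J ∈ T := by
      refine (hT J).2 ⟨hJ, ?_⟩
      rw [← hcard, Nat.one_le_iff_ne_zero, Finset.card_ne_zero, ← Finset.not_disjoint_iff_nonempty_inter]
      exact hd
    have hpr : pr (edgeProb k p) (edges C ∪ edges C') = W J := by
      rw [pr_eq_pow, hW, eq_div_iff (by positivity), ← pow_add, ← hcard,
        Finset.card_union_add_card_inter, card_edges_of_mem hC, card_edges_of_mem hC', two_mul]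
      intro e he
      rcases Finset.mem_union.1 he with he | he
      · exact ncard_of_mem_edges hH.2 hC e he
      · exact ncard_of_mem_edges hH.2 hC' e he
    calc _ = I (inter C C') C * I (inter C C') C' * W J := by simp [hI, h1, h2, hpr]
      _ ≤ ∑ D ∈ allCopies J β, I D C * I D C' * W J :=
        Finset.single_le_sum (f := fun D => I D C * I D C' * W J) (fun D _ => hnn C C' J D) hDJ
      _ ≤ _ := Finset.single_le_sum (f := fun J => ∑ D ∈ allCopies J β, I D C * I D C' * W J)
        (fun J _ => Finset.sum_nonneg fun D _ => hnn C C' J D) hJT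
  have hstep : corr (edgeProb k p) (allCopies H β) edges ≤ ∑ C ∈ allCopies H β,
      ∑ C' ∈ allCopies H β, ∑ J ∈ T, ∑ D ∈ allCopies J β, I D C * I D C' * W J := by
    refine Finset.sum_le_sum fun C hC => ?_
    refine (Finset.sum_le_sum fun C' hC' => hpair C hC C' (Finset.mem_filter.1 hC').1
      (Finset.mem_filter.1 hC').2).trans ?_
    exact Finset.sum_le_sum_of_subset_of_nonneg (Finset.filter_subset _ _) fun C' _ _ =>
      Finset.sum_nonneg fun J _ => Finset.sum_nonneg fun D _ => hnn C C' J D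
  refine hstep.trans (le_of_eq ?_)
  have hswap : ∑ C ∈ allCopies H β,
      ∑ C' ∈ allCopies H β, ∑ J ∈ T, ∑ D ∈ allCopies J β, I D C * I D C' * W J =
      ∑ J ∈ T, ∑ D ∈ allCopies J β, (∑ C ∈ allCopies H β, I D C) ^ 2 * W J := by
    have h1 : ∀ C, ∑ C' ∈ allCopies H β, ∑ J ∈ T, ∑ D ∈ allCopies J β, I D C * I D C' * W J =
        ∑ J ∈ T, ∑ D ∈ allCopies J β, I D C * (∑ C' ∈ allCopies H β, I D C') * W J := by
      intro C
      rw [Finset.sum_comm]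
      refine Finset.sum_congr rfl fun J _ => ?_
      rw [Finset.sum_comm]
      refine Finset.sum_congr rfl fun D _ => ?_
      rw [Finset.mul_sum, Finset.sum_mul]
    simp only [h1]
    rw [Finset.sum_comm]
    refine Finset.sum_congr rfl fun J _ => ?_
    rw [Finset.sum_comm]
    refine Finset.sum_congr rfl fun D _ => ?_
    rw [sq, Finset.sum_mul, Finset.sum_mul]
  rw [hswap]
  refine Finset.sum_congr rfl fun J hJ => ?_
  obtain ⟨hJH, -⟩ := (hT J).1 hJ
  have hcount : ∀ D ∈ allCopies J β, (∑ C ∈ allCopies H β, I D C) =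
      (allCopies H β).card * (copies J H).ncard / (allCopies J β).card := by
    intro D hD
    have h := card_allCopies_mul H hD
    have h0 : ((allCopies J β).card : ℝ) ≠ 0 := by
      exact_mod_cast (Finset.card_pos.2 ⟨D, hD⟩).ne'
    rw [eq_div_iff h0]
    simp only [hI]
    rw [Finset.sum_boole, mul_comm]
    exact_mod_cast h
  rw [Finset.sum_congr rfl fun D hD => by rw [hcount D hD], Finset.sum_const, nsmul_eq_mul,
    meanCopies_eq hH.2, meanCopies_eq fun e he => hH.2 e (hJH.2 he)]
  rcases eq_or_ne ((allCopies J β).card : ℝ) 0 with h0 | h0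
  · simp [h0]
  · simp only [hW, hm]
    field_simp
    ring

/-- The hypergraph consisting of the single edge `e` and its vertices. -/
def edgeGraph {γ : Type*} (e : Set γ) : Hypergraph γ := ⟨e, {e}, fun _ h => h.subset⟩

/-- If no subgraph of `H` with an edge has fewer expected copies than `G`, then the expected number
of copies of `G` that share an edge with a given copy of `H` is `O(p)`. -/
lemma mean_filter_not_disjoint_le [Nonempty β] (hp : 0 < p) {G H : Hypergraph α}
    (hH : IsKGraph k H) (hGH : IsSubgraph G H)
    {T : Finset (Hypergraph α)} (hT : ∀ J, J ∈ T ↔ IsSubgraph J H ∧ 1 ≤ J.edgeSet.ncard)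
    (hle : ∀ J ∈ T, meanCopies k p G β ≤ meanCopies k p J β)
    {C : Hypergraph β} (hC : C ∈ allCopies H β) :
    mean (edgeProb k p) ((allCopies G β).filter fun D => ¬ Disjoint (edges C) (edges D)) edges ≤
      (H.edgeSet.ncard * ∑ J ∈ T, ((copies J G).ncard : ℝ)) * p := by
  have hG : ∀ e ∈ G.edgeSet, e.ncard = k := fun e he => hH.2 e (hGH.2 he)
  have hsub : ((allCopies G β).filter fun D => ¬ Disjoint (edges C) (edges D)) ⊆
      (edges C).biUnion fun e => (allCopies G β).filter fun D => IsSubgraph (edgeGraph e) D := by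
    intro D hD
    obtain ⟨hD, hd⟩ := Finset.mem_filter.1 hD
    obtain ⟨e, he, he'⟩ := Finset.not_disjoint_iff.1 hd
    refine Finset.mem_biUnion.2 ⟨e, he, Finset.mem_filter.2 ⟨hD, ?_, ?_⟩⟩
    · exact edge_subset (mem_edges.1 he')
    · exact Set.singleton_subset_iff.2 (mem_edges.1 he')
  have hone : ∀ e ∈ edges C,
      ((((allCopies G β).filter fun D => IsSubgraph (edgeGraph e) D).card : ℕ) : ℝ) *
        p ^ G.edgeSet.ncard ≤ (∑ J ∈ T, ((copies J G).ncard : ℝ)) * p := by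
    intro e he
    have he' := mem_edges.1 he
    have hsubC : IsSubgraph (edgeGraph e) C := ⟨edge_subset he', Set.singleton_subset_iff.2 he'⟩
    obtain ⟨J, hJ, hDJ⟩ := exists_mem_allCopies hC hsubC
    have hJ1 : J.edgeSet.ncard = 1 := by
      rw [← (mem_allCopies.1 hDJ).ncard_edgeSet]
      simp [edgeGraph]
    have hJT : J ∈ T := (hT J).2 ⟨hJ, hJ1.ge⟩
    have hcount := card_allCopies_mul G hDJ
    have hN : (0 : ℝ) < (allCopies J β).card := by
      exact_mod_cast Finset.card_pos.2 ⟨_, hDJ⟩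
    have hmean := hle J hJT
    rw [meanCopies_eq hG, meanCopies_eq fun e he => hH.2 e (hJ.2 he), hJ1, pow_one] at hmean
    have hc : ((allCopies J β).card : ℝ) *
        (((allCopies G β).filter fun D => IsSubgraph (edgeGraph e) D).card : ℕ) =
        (allCopies G β).card * (copies J G).ncard := by exact_mod_cast hcount
    have hcJ : ((copies J G).ncard : ℝ) ≤ ∑ J ∈ T, ((copies J G).ncard : ℝ) :=
      Finset.single_le_sum (f := fun J => ((copies J G).ncard : ℝ))
        (fun J _ => Nat.cast_nonneg _) hJT
    refine le_of_mul_le_mul_left ?_ hN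
    calc ((allCopies J β).card : ℝ) *
          ((((allCopies G β).filter fun D => IsSubgraph (edgeGraph e) D).card : ℕ) *
            p ^ G.edgeSet.ncard)
        = (copies J G).ncard * ((allCopies G β).card * p ^ G.edgeSet.ncard) := by
          rw [← mul_assoc, hc]; ring
      _ ≤ (copies J G).ncard * ((allCopies J β).card * p) :=
          mul_le_mul_of_nonneg_left hmean (Nat.cast_nonneg _)
      _ ≤ (∑ J ∈ T, ((copies J G).ncard : ℝ)) * ((allCopies J β).card * p) :=
          mul_le_mul_of_nonneg_right hcJ (by positivity)
      _ = _ := by ring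
  rw [mean, Finset.sum_congr rfl fun D hD => pr_edges hG (Finset.mem_filter.1 hD).1,
    Finset.sum_const, nsmul_eq_mul]
  have hcard : ((((allCopies G β).filter fun D => ¬ Disjoint (edges C) (edges D)).card : ℕ) : ℝ) ≤
      ∑ e ∈ edges C,
        ((((allCopies G β).filter fun D => IsSubgraph (edgeGraph e) D).card : ℕ) : ℝ) := by
    exact_mod_cast (Finset.card_le_card hsub).trans Finset.card_biUnion_le
  calc _ ≤ (∑ e ∈ edges C,
        ((((allCopies G β).filter fun D => IsSubgraph (edgeGraph e) D).card : ℕ) : ℝ)) *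
          p ^ G.edgeSet.ncard := mul_le_mul_of_nonneg_right hcard (by positivity)
    _ ≤ ∑ e ∈ edges C, (∑ J ∈ T, ((copies J G).ncard : ℝ)) * p := by
        rw [Finset.sum_mul]; exact Finset.sum_le_sum hone
    _ = _ := by rw [Finset.sum_const, nsmul_eq_mul, card_edges_of_mem hC, mul_assoc]

lemma image_val_eq_iff {γ : Type*} {c : Set γ} (s : Set c) :
    Subtype.val '' s = c ↔ s = Set.univ := by
  rw [← Subtype.val_injective.image_injective.eq_iff (b := Set.univ), Set.image_univ,
    Subtype.range_coe]

/-- The copies of a single `k`-edge are the `k`-element sets. -/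
lemma mem_allCopies_edgeGraph {e₀ : Set α} (hk : 0 < k) (he₀ : e₀.ncard = k) {D : Hypergraph β} :
    D ∈ allCopies (edgeGraph e₀) β ↔ ∃ e : Set β, e.ncard = k ∧ edgeGraph e = D := by
  have hfin : e₀.Finite := Set.finite_of_ncard_pos (he₀ ▸ hk)
  rw [mem_allCopies]
  constructor
  · intro h
    have : Nonempty β := by
      obtain ⟨F, -⟩ := h
      obtain ⟨x, hx⟩ := Set.nonempty_of_ncard_ne_zero (he₀ ▸ hk.ne' : e₀.ncard ≠ 0)
      exact ⟨(F ⟨x, hx⟩ : β)⟩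
    obtain ⟨f, hf, rfl⟩ := h.exists_image
    refine ⟨f '' e₀, ?_, ?_⟩
    · exact (Set.InjOn.ncard_image hf).trans he₀
    · ext1 <;> simp [edgeGraph]
  · rintro ⟨e, he, rfl⟩
    have : Finite e₀ := hfin
    obtain ⟨F⟩ : Nonempty (e₀ ≃ e) := Finite.card_eq.1 (by
      rw [Nat.card_coe_set_eq, Nat.card_coe_set_eq, he₀, he])
    refine ⟨F, fun s => (image_val_eq_iff s).trans (Iff.trans ?_ (image_val_eq_iff (F '' s)).symm)⟩
    have hF : F '' (Set.univ : Set e₀) = Set.univ := by simp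
    exact ⟨fun h => by rw [← hF]; exact congrArg (F '' ·) h,
      fun h => F.injective.image_injective (h.trans hF.symm)⟩

lemma edgeGraph_injective {γ : Type*} : Function.Injective (edgeGraph : Set γ → Hypergraph γ) :=
  fun _ _ h => congrArg Hypergraph.vertexSet h

/-- Counting copies of a single edge is counting edges. -/
lemma count_allCopies_edgeGraph {e₀ : Set α} (hk : 0 < k) (he₀ : e₀.ncard = k)
    (S : Finset (Set β)) :
    count (allCopies (edgeGraph e₀) β) edges S = (S.filter fun e => e.ncard = k).card := by
  have himg : allCopies (edgeGraph e₀) β =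
      (Finset.univ.filter fun e : Set β => e.ncard = k).image edgeGraph := by
    ext D
    rw [mem_allCopies_edgeGraph hk he₀]
    simp
  have hedges : ∀ e : Set β, edges (edgeGraph e) = {e} := fun e => by
    ext; simp [edgeGraph]
  rw [count, himg, Finset.sum_image fun _ _ _ _ h => edgeGraph_injective h]
  simp only [incl, hedges, Finset.singleton_subset_iff]
  rw [Finset.sum_boole, Finset.filter_filter]
  congr 2
  ext e
  simp [and_comm]

end RandomHypergraph

/-! ### The law of the random hypergraph as a finite sum -/

section Law

open scoped Classical

variable {α : Type*} {k n : ℕ} {p : unitInterval}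

lemma X_coe (J : Hypergraph α) (S : Finset (Set (Fin n))) :
    X J n S = count (allCopies J (Fin n)) edges S := by
  have h : copies J (ofEdges (S : Set (Set (Fin n)))) =
      ((allCopies J (Fin n)).filter fun C => edges C ⊆ S : Finset _) := by
    ext C
    simp only [copies, IsSubgraph, ofEdges, Set.mem_ofPred_eq, Finset.coe_filter, mem_allCopies,
      ← Finset.coe_subset, coe_edges]
    simp [and_comm]
  rw [X, h, Set.ncard_coe_finset, count]
  simp only [incl]
  rw [Finset.sum_boole]

lemma edgeLaw_real_singleton (S : Finset (Set (Fin n))) :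
    (edgeLaw k n p).real {(S : Set (Set (Fin n)))} = weight (edgeProb k p) S := by
  unfold edgeLaw
  by_cases hS : (S : Set (Set (Fin n))) ⊆ {e : Set (Fin n) | e.ncard = k}
  · rw [setBernoulli_real_singleton p hS (Set.toFinite _), weight_eq_prod_mul_prod]
    congr 1
    · rw [Set.ncard_coe_finset]
      exact (pr_eq_pow fun e he => hS he).symm
    · have h : ∀ e ∈ Sᶜ, (1 - edgeProb k (p : ℝ) e) =
          if e.ncard = k then 1 - (p : ℝ) else 1 := fun e _ => by
        unfold edgeProb; split_ifs <;> simp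
      rw [Finset.prod_congr rfl h, ← Finset.prod_filter, Finset.prod_const, ← Set.ncard_coe_finset]
      congr 2
      ext e
      simp [and_comm]
  · rw [measureReal_def, setBernoulli_singleton_of_not_subset p hS, ENNReal.toReal_zero]
    obtain ⟨e, he, hek⟩ := Set.not_subset.1 hS
    refine (Finset.prod_eq_zero (Finset.mem_univ e) ?_).symm
    have h1 : e ∈ S := he
    have h2 : ¬ e.ncard = k := hek
    simp [h1, edgeProb, h2]

lemma integral_edgeLaw (f : Set (Set (Fin n)) → ℝ) :
    ∫ S, f S ∂(edgeLaw k n p) = 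
      expect (edgeProb k p) fun S : Finset (Set (Fin n)) => f S := by
  have : IsProbabilityMeasure (edgeLaw k n p) := by unfold edgeLaw; infer_instance
  rw [integral_fintype (Integrable.of_finite), expect,
    ← Equiv.sum_comp (Fintype.finsetEquivSet (α := Set (Fin n)))]
  refine Finset.sum_congr rfl fun S _ => ?_
  rw [Fintype.finsetEquivSet_apply, edgeLaw_real_singleton, smul_eq_mul]

lemma EX_eq_meanCopies (J : Hypergraph α) : EX k J n p = meanCopies k p J (Fin n) := by
  rw [EX, integral_edgeLaw, meanCopies, ← expect_count]
  simp only [X_coe]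

lemma lowerTail_eq_expect (J : Hypergraph α) (ε : ℝ) :
    lowerTail k J n p ε = expect (edgeProb k p) fun S =>
      ind (count (allCopies J (Fin n)) edges S ≤ (1 - ε) * meanCopies k p J (Fin n)) := by
  have hm : MeasurableSet {S : Set (Set (Fin n)) | X J n S ≤ (1 - ε) * EX k J n p} :=
    (Set.toFinite _).measurableSet
  rw [lowerTail, ← integral_indicator_one hm, integral_edgeLaw, EX_eq_meanCopies]
  simp only [Set.indicator_apply, Set.mem_ofPred_eq, X_coe, Pi.one_apply, ind]

end Law

/-! ### Real inequalities -/

lemma exp_neg_le_of_nonneg {x : ℝ} (hx : 0 ≤ x) : Real.exp (-x) ≤ 1 - x + x ^ 2 := by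
  have h := Real.add_one_le_exp x
  have h1 : Real.exp (-x) * Real.exp x = 1 := by rw [← Real.exp_add]; simp
  have h0 := Real.exp_pos (-x)
  have h2 : Real.exp (-x) * (1 + x) ≤ 1 := by nlinarith
  have h3 : (0 : ℝ) ≤ x ^ 3 := by positivity
  have h4 : Real.exp (-x) * (1 + x) ≤ (1 - x + x ^ 2) * (1 + x) := by nlinarith
  exact le_of_mul_le_mul_right h4 (by linarith)

lemma exp_neg_add_sq_le_one_sub {x : ℝ} (hx : 0 ≤ x) (hx' : x ≤ 1 / 2) :
    Real.exp (-(x + x ^ 2)) ≤ 1 - x := by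
  have h := Real.quadratic_le_exp_of_nonneg (x := x + x ^ 2) (by positivity)
  have h1 : Real.exp (-(x + x ^ 2)) * Real.exp (x + x ^ 2) = 1 := by rw [← Real.exp_add]; simp
  have h2 : 1 ≤ (1 - x) * (1 + (x + x ^ 2) + (x + x ^ 2) ^ 2 / 2) := by
    have h4 : 0 ≤ x ^ 2 * (1 - x - x ^ 2 - x ^ 3) := by
      refine mul_nonneg (sq_nonneg x) ?_
      have : x ^ 2 ≤ 1 / 4 := by nlinarith
      have : x ^ 3 ≤ 1 / 8 := by nlinarith
      linarith
    nlinarith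
  have h3 : 1 ≤ (1 - x) * Real.exp (x + x ^ 2) :=
    h2.trans (mul_le_mul_of_nonneg_left h (by linarith))
  refine le_of_mul_le_mul_right ?_ (Real.exp_pos (x + x ^ 2))
  rw [h1]
  exact h3

/-- Comparison of the exponent in Janson's bound with the exponent of a Poisson variable. -/
lemma one_sub_exp_sub_le {t δ d : ℝ} (ht : 0 ≤ t) (hδ : 0 ≤ δ) (hδd : δ ≤ d) (hd : d ≤ 1) :
    (1 - Real.exp (-t)) - 2 * d * t ^ 2 ≤ (1 - Real.exp (-(t * (1 + δ)))) / (1 + δ) := by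
  rw [le_div_iff₀ (by linarith)]
  have h1 : Real.exp (-(t * (1 + δ))) = Real.exp (-t) * Real.exp (-(t * δ)) := by
    rw [← Real.exp_add]; ring_nf
  have h2 := exp_neg_le_of_nonneg (mul_nonneg ht hδ)
  have h3 : 1 - t ≤ Real.exp (-t) := by linarith [Real.add_one_le_exp (-t)]
  have h4 : Real.exp (-t) ≤ 1 := Real.exp_le_one_iff.2 (by linarith)
  have h0 := (Real.exp_pos (-t)).le
  set E := Real.exp (-t)
  have h5 : E * Real.exp (-(t * δ)) ≤ E * (1 - t * δ + (t * δ) ^ 2) := mul_le_mul_of_nonneg_left h2 h0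
  have h6 : 1 - t ^ 2 ≤ E * (1 + t) := by nlinarith
  have h7 : δ * (1 - t ^ 2) ≤ δ * (E * (1 + t)) := mul_le_mul_of_nonneg_left h6 hδ
  have h8 : E * (t * δ) ^ 2 ≤ δ * t ^ 2 := by
    have : (t * δ) ^ 2 ≤ δ * t ^ 2 := by
      have : δ ^ 2 ≤ δ := by nlinarith
      nlinarith [sq_nonneg t]
    nlinarith [sq_nonneg (t * δ)]
  have h9 : 2 * δ * t ^ 2 ≤ 2 * d * t ^ 2 * (1 + δ) := by
    have : δ * t ^ 2 ≤ d * t ^ 2 := mul_le_mul_of_nonneg_right hδd (sq_nonneg t)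
    have : 0 ≤ d * t ^ 2 * δ := mul_nonneg (mul_nonneg (hδ.trans hδd) (sq_nonneg t)) hδ
    linarith
  rw [h1]
  linarith

/-! ### Janson's inequality for the lower tail -/

section Bounds

variable {ι κ κ' : Type*} [Fintype ι] [DecidableEq ι] {q : ι → ℝ}
  {s : Finset κ} {A : κ → Finset ι} {s' : Finset κ'} {B : κ' → Finset ι}

open scoped Classical

lemma ind_of_true {P : Prop} (h : P) : ind P = 1 := if_pos h

lemma ind_of_false {P : Prop} (h : ¬ P) : ind P = 0 := if_neg h

lemma ind_nonneg (P : Prop) : 0 ≤ ind P := by unfold ind; split_ifs <;> simp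

/-- The probability of an event. -/
def prob (q : ι → ℝ) (D : Finset ι → Prop) : ℝ := expect q fun S => ind (D S)

/-- Janson's inequality. -/
lemma prob_count_le (hq : ∀ i, q i ∈ Set.Icc (0 : ℝ) 1) (hμ : 0 < mean q s A)
    (hΛ : 0 < corr q s A) {ε : ℝ} (hε : ε ∈ Set.Ioc (0 : ℝ) 1) :
    prob q (fun S => count s A S ≤ (1 - ε) * mean q s A) ≤
      Real.exp (-(phi (-ε) * (mean q s A ^ 2 / corr q s A))) := by
  set μ := mean q s A
  set Λ := corr q s A
  set P := prob q (fun S => count s A S ≤ (1 - ε) * μ) with hP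
  have key : ∀ u : ℝ, 0 ≤ u →
      P ≤ Real.exp (-((1 - Real.exp (-u) - u * (1 - ε)) * (μ ^ 2 / Λ))) := by
    intro u hu
    set t := u * μ / Λ with ht
    have ht0 : 0 ≤ t := by positivity
    have h1 : P ≤ expect q fun S =>
        Real.exp (t * ((1 - ε) * μ)) * Real.exp (-(t * count s A S)) := by
      refine expect_mono hq fun S => ?_
      rw [← Real.exp_add]
      unfold ind
      split_ifs with h
      · refine Real.one_le_exp ?_
        have := mul_le_mul_of_nonneg_left h ht0
        linarith
      · exact (Real.exp_pos _).le
    rw [expect_const_mul] at h1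
    have hL : (expect q fun S => Real.exp (-(t * count s A S))) ≤
        Real.exp (-(μ ^ 2 / Λ * (1 - Real.exp (-(t * (Λ / μ)))))) :=
      expect_exp_neg_le hq ht0 hμ hΛ
    refine h1.trans ((mul_le_mul_of_nonneg_left hL (Real.exp_pos _).le).trans (le_of_eq ?_))
    rw [← Real.exp_add]
    have h2 : t * (Λ / μ) = u := by rw [ht]; field_simp
    rw [h2]
    congr 1
    rw [ht]
    field_simp
    ring
  rcases eq_or_lt_of_le hε.2 with h1 | h1
  · have hlim : Tendsto (fun u : ℝ => Real.exp (-((1 - Real.exp (-u) - u * (1 - ε)) * (μ ^ 2 / Λ))))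
        atTop (𝓝 (Real.exp (-((1 - 0 - 0) * (μ ^ 2 / Λ))))) := by
      simp only [h1, sub_self, mul_zero]
      refine (Real.continuous_exp.tendsto _).comp ?_
      exact (((tendsto_const_nhds.sub (Real.tendsto_exp_neg_atTop_nhds_zero)).sub
        tendsto_const_nhds).mul_const _).neg
    have hphi : phi (-ε) = 1 - 0 - 0 := by simp [phi, h1]
    rw [hphi]
    exact ge_of_tendsto hlim ((eventually_ge_atTop 0).mono key)
  · have h2 : 0 < 1 - ε := by linarith
    have hu : 0 ≤ -Real.log (1 - ε) := by
      have := Real.log_nonpos h2.le (by linarith [hε.1])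
      linarith
    refine (key _ hu).trans (le_of_eq ?_)
    rw [neg_neg, Real.exp_log h2, phi]
    ring_nf

/-! ### Lower bounds for the Laplace transform, and concentration of the tilted measure -/

lemma exp_neg_mul_count {t : ℝ} (S : Finset ι) :
    Real.exp (-(t * count s A S)) = ∏ b ∈ s, (1 - (1 - Real.exp (-t)) * incl (A b) S) := by
  rw [count, Finset.mul_sum, ← Finset.sum_neg_distrib, Real.exp_sum]
  refine Finset.prod_congr rfl fun b _ => ?_
  unfold incl
  split_ifs <;> simp

lemma exp_le_prod_one_sub (hq : ∀ i, q i ∈ Set.Icc (0 : ℝ) 1) {a r : ℝ}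
    (ha : a ∈ Set.Icc (0 : ℝ) 1) (hr : r ≤ 1 / 2) (hA : ∀ b ∈ s, pr q (A b) ≤ r) :
    Real.exp (-(a * mean q s A + a ^ 2 * r * mean q s A)) ≤ ∏ b ∈ s, (1 - a * pr q (A b)) := by
  have h1 : Real.exp (-(a * mean q s A + a ^ 2 * r * mean q s A)) =
      ∏ b ∈ s, Real.exp (-(a * pr q (A b) + a ^ 2 * r * pr q (A b))) := by
    rw [← Real.exp_sum, mean, Finset.sum_neg_distrib, Finset.sum_add_distrib, Finset.mul_sum,
      Finset.mul_sum]
  rw [h1]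
  refine Finset.prod_le_prod (fun b _ => (Real.exp_pos _).le) fun b hb => ?_
  have hb0 := pr_nonneg hq (A b)
  have hbr := hA b hb
  have h2 : 0 ≤ a * pr q (A b) := mul_nonneg ha.1 hb0
  have h3 : a * pr q (A b) ≤ pr q (A b) := mul_le_of_le_one_left hb0 ha.2
  refine le_trans (Real.exp_le_exp.2 (neg_le_neg ?_))
    (exp_neg_add_sq_le_one_sub h2 (by linarith))
  have : a ^ 2 * pr q (A b) * pr q (A b) ≤ a ^ 2 * pr q (A b) * r :=
    mul_le_mul_of_nonneg_left hbr (by positivity)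
  linarith

lemma exp_le_prob_count_eq_zero (hq : ∀ i, q i ∈ Set.Icc (0 : ℝ) 1) {r : ℝ} (hr : r ≤ 1 / 2)
    (hA : ∀ b ∈ s, pr q (A b) ≤ r) :
    Real.exp (-((1 + r) * mean q s A)) ≤ prob q fun S => count s A S = 0 := by
  have h1 := (exp_le_prod_one_sub hq (a := 1) ⟨zero_le_one, le_rfl⟩ hr hA).trans
    (prod_one_sub_le_expect hq ⟨zero_le_one, le_rfl⟩ s A)
  refine le_trans (le_of_eq (by ring_nf)) (h1.trans (expect_mono hq fun S => ?_))
  by_cases h : ∀ b ∈ s, ¬ A b ⊆ S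
  · have h0 : count s A S = 0 := Finset.sum_eq_zero fun b hb => by simp [incl, h b hb]
    rw [ind_of_true h0, Finset.prod_eq_one fun b hb => by simp [incl, h b hb]]
  · push Not at h
    obtain ⟨b, hb, hbS⟩ := h
    rw [Finset.prod_eq_zero hb (by simp [incl, hbS])]
    exact ind_nonneg _

lemma exp_le_expect_exp_neg (hq : ∀ i, q i ∈ Set.Icc (0 : ℝ) 1) {t r : ℝ} (ht : 0 ≤ t)
    (hr : r ≤ 1 / 2) (hA : ∀ b ∈ s, pr q (A b) ≤ r) :
    Real.exp (-((1 - Real.exp (-t)) * mean q s A + (1 - Real.exp (-t)) ^ 2 * r * mean q s A)) ≤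
      expect q fun S => Real.exp (-(t * count s A S)) := by
  have h4 : Real.exp (-t) ≤ 1 := Real.exp_le_one_iff.2 (by linarith)
  have ha : 1 - Real.exp (-t) ∈ Set.Icc (0 : ℝ) 1 :=
    ⟨by linarith, by linarith [Real.exp_pos (-t)]⟩
  simp only [exp_neg_mul_count]
  exact (exp_le_prod_one_sub hq ha hr hA).trans (prod_one_sub_le_expect hq ha s A)

/-- If pairs of intersecting members contribute little to the second moment, the Laplace transform
is at most about that of a Poisson variable. -/
lemma expect_exp_neg_le_poisson (hq : ∀ i, q i ∈ Set.Icc (0 : ℝ) 1) {t d : ℝ} (ht : 0 ≤ t)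
    (hμ : 0 < mean q s A) (hA : ∀ a ∈ s, (A a).Nonempty) (hd : d ≤ 1)
    (hΛ : corr q s A ≤ (1 + d) * mean q s A) :
    (expect q fun S => Real.exp (-(t * count s A S))) ≤
      Real.exp (mean q s A * (-(1 - Real.exp (-t)) + 2 * d * t ^ 2)) := by
  have hle := mean_le_corr hq hA
  set μ := mean q s A
  have hΛ0 : 0 < corr q s A := hμ.trans_le hle
  refine (expect_exp_neg_le hq ht hμ hΛ0).trans (Real.exp_le_exp.2 ?_)
  set Λ := corr q s A
  have h1 := one_sub_exp_sub_le ht (δ := Λ / μ - 1) (d := d)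
    (by rw [sub_nonneg, le_div_iff₀ hμ]; linarith)
    (by rw [sub_le_iff_le_add, div_le_iff₀ hμ]; linarith) hd
  rw [add_sub_cancel] at h1
  have h2 : μ ^ 2 / Λ * (1 - Real.exp (-(t * (Λ / μ)))) =
      μ * ((1 - Real.exp (-(t * (Λ / μ)))) / (Λ / μ)) := by
    field_simp
  rw [h2]
  have := mul_le_mul_of_nonneg_left h1 hμ.le
  linarith

/-- Change of the Laplace transform when the tilting parameter is moved from `t` to `t + h`. -/
lemma expect_exp_neg_add_le (hq : ∀ i, q i ∈ Set.Icc (0 : ℝ) 1) {t h r d : ℝ} (ht : 0 ≤ t)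
    (hth : 0 ≤ t + h) (hh : |h| ≤ 1)
    (hr : r ≤ 1 / 2) (hAr : ∀ b ∈ s, pr q (A b) ≤ r)
    (hμ : 0 < mean q s A) (hA : ∀ a ∈ s, (A a).Nonempty) (hd : d ≤ 1)
    (hΛ : corr q s A ≤ (1 + d) * mean q s A) :
    (expect q fun S => Real.exp (-((t + h) * count s A S))) ≤
      (expect q fun S => Real.exp (-(t * count s A S))) *
        Real.exp (mean q s A * (-h * Real.exp (-t) + h ^ 2 +
          (2 * d * (t + h) ^ 2 + (1 - Real.exp (-t)) ^ 2 * r))) := by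
  have h1 := expect_exp_neg_le_poisson hq hth hμ hA hd hΛ
  have h2 := exp_le_expect_exp_neg hq ht hr hAr
  refine h1.trans (le_trans ?_ (mul_le_mul_of_nonneg_right h2 (Real.exp_pos _).le))
  rw [← Real.exp_add, Real.exp_le_exp]
  set μ := mean q s A
  have h3 : Real.exp (-(t + h)) = Real.exp (-t) * Real.exp (-h) := by
    rw [← Real.exp_add]; ring_nf
  have h4 : Real.exp (-h) - 1 + h ≤ h ^ 2 := by
    have := (abs_le.1 (Real.abs_exp_sub_one_sub_id_le (x := -h) (by simpa using hh))).2
    simpa using this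
  have h5 : Real.exp (-t) ≤ 1 := Real.exp_le_one_iff.2 (by linarith)
  have h6 := Real.exp_pos (-t)
  have h7 : Real.exp (-t) * (Real.exp (-h) - 1 + h) ≤ h ^ 2 := by
    calc _ ≤ Real.exp (-t) * h ^ 2 := mul_le_mul_of_nonneg_left h4 h6.le
      _ ≤ _ := mul_le_of_le_one_left (sq_nonneg h) h5
  have h8 := mul_le_mul_of_nonneg_left h7 hμ.le
  rw [h3]
  linarith

/-- Chernoff's bound for the tilted measure with density proportional to `exp (-t X)`, in both
directions: deviations of at least `η μ` from `exp (-t) μ`, downwards for `σ = 1` and upwards for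
`σ = -1`. -/
lemma tilted_tail_le (hq : ∀ i, q i ∈ Set.Icc (0 : ℝ) 1) {t η r d σ : ℝ}
    (hη0 : 0 ≤ η) (hη1 : η ≤ 1) (hηt : η ≤ t) (hσ : σ = 1 ∨ σ = -1)
    (hr : r ≤ 1 / 2) (hAr : ∀ b ∈ s, pr q (A b) ≤ r)
    (hμ : 0 < mean q s A) (hA : ∀ a ∈ s, (A a).Nonempty) (hd0 : 0 ≤ d) (hd : d ≤ 1)
    (hΛ : corr q s A ≤ (1 + d) * mean q s A)
    (herr : 2 * d * (t + η) ^ 2 + (1 - Real.exp (-t)) ^ 2 * r ≤ η ^ 2 / 8) :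
    (expect q fun S => Real.exp (-(t * count s A S)) *
      ind (σ * (count s A S - Real.exp (-t) * mean q s A) < -(η * mean q s A))) ≤
      (expect q fun S => Real.exp (-(t * count s A S))) *
        Real.exp (-(η ^ 2 / 8 * mean q s A)) := by
  set μ := mean q s A
  set h := η / 2 with hh
  have hσ2 : σ ^ 2 = 1 := by rcases hσ with rfl | rfl <;> norm_num
  have ht : 0 ≤ t := hη0.trans hηt
  have habs : |σ * h| ≤ 1 := by
    rw [abs_mul, show |σ| = 1 by rcases hσ with rfl | rfl <;> simp, one_mul, hh, abs_le]
    constructor <;> linarith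
  have hth : 0 ≤ t + σ * h := by rcases hσ with rfl | rfl <;> linarith
  have h1 := expect_exp_neg_add_le hq ht hth habs hr hAr hμ hA hd hΛ
  have h2 : ∀ S, Real.exp (-(t * count s A S)) *
      ind (σ * (count s A S - Real.exp (-t) * μ) < -(η * μ)) ≤
      Real.exp (h * (σ * (Real.exp (-t) * μ) - η * μ)) *
        Real.exp (-((t + σ * h) * count s A S)) := by
    intro S
    unfold ind
    split_ifs with hS
    · rw [mul_one, ← Real.exp_add, Real.exp_le_exp]
      have h0 : 0 ≤ h := by rw [hh]; linarith
      have := mul_le_mul_of_nonneg_left hS.le h0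
      linarith
    · rw [mul_zero]; positivity
  refine (expect_mono hq h2).trans ?_
  rw [expect_const_mul]
  refine (mul_le_mul_of_nonneg_left h1 (Real.exp_pos _).le).trans ?_
  rw [mul_left_comm]
  refine mul_le_mul_of_nonneg_left ?_ (expect_exp_pos hq).le
  rw [← Real.exp_add, Real.exp_le_exp]
  have h3 : 2 * d * (t + σ * h) ^ 2 ≤ 2 * d * (t + η) ^ 2 := by
    refine mul_le_mul_of_nonneg_left ?_ (by linarith)
    refine pow_le_pow_left₀ hth ?_ 2
    rcases hσ with rfl | rfl <;> linarith
  have h4 : μ * (2 * d * (t + σ * h) ^ 2 + (1 - Real.exp (-t)) ^ 2 * r) ≤ μ * (η ^ 2 / 8) :=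
    mul_le_mul_of_nonneg_left (by linarith) hμ.le
  have h5 : (σ * h) ^ 2 = η ^ 2 / 4 := by rw [mul_pow, hσ2, hh]; ring
  rw [h5]
  have h6 : h * (η * μ) = μ * (η ^ 2 / 2) := by rw [hh]; ring
  linarith

/-- The lower bound by change of measure: an event `D` whose tilted probability exceeds `c` has
probability at least about `c * exp (-φ(-a) μ)`, where `1 - a = exp (-t)`. -/
lemma le_prob_of_tilted (hq : ∀ i, q i ∈ Set.Icc (0 : ℝ) 1) {t η r d c : ℝ}
    (hη0 : 0 ≤ η) (hη1 : η ≤ 1) (hηt : η ≤ t)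
    (hr : r ≤ 1 / 2) (hAr : ∀ b ∈ s, pr q (A b) ≤ r)
    (hμ : 0 < mean q s A) (hA : ∀ a ∈ s, (A a).Nonempty) (hd0 : 0 ≤ d) (hd : d ≤ 1)
    (hΛ : corr q s A ≤ (1 + d) * mean q s A)
    (herr : 2 * d * (t + η) ^ 2 + (1 - Real.exp (-t)) ^ 2 * r ≤ η ^ 2 / 8)
    {D : Finset ι → Prop}
    (hc : Real.exp (-(η ^ 2 / 8 * mean q s A)) ≤ c)
    (hD : c * (expect q fun S => Real.exp (-(t * count s A S))) ≤
      expect q fun S => Real.exp (-(t * count s A S)) * ind (D S)) :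
    (c - Real.exp (-(η ^ 2 / 8 * mean q s A))) *
      Real.exp (mean q s A * (t * (Real.exp (-t) - η) - (1 - Real.exp (-t)) -
        (1 - Real.exp (-t)) ^ 2 * r)) ≤ prob q D := by
  have hlow := tilted_tail_le hq hη0 hη1 hηt (Or.inl rfl) hr hAr hμ hA hd0 hd hΛ herr
  have hZ := exp_le_expect_exp_neg hq (hη0.trans hηt) hr hAr
  set μ := mean q s A
  set Z := expect q fun S => Real.exp (-(t * count s A S))
  set K := Real.exp (t * ((Real.exp (-t) - η) * μ)) with hK
  have hpt : ∀ S, K * (Real.exp (-(t * count s A S)) * ind (D S) -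
      Real.exp (-(t * count s A S)) *
        ind (1 * (count s A S - Real.exp (-t) * μ) < -(η * μ))) ≤ ind (D S) := by
    intro S
    rw [← mul_sub, ← mul_assoc, ← Real.exp_add]
    unfold ind
    split_ifs with h1 h2 h2
    · simp
    · rw [sub_zero, mul_one, Real.exp_le_one_iff]
      have : 0 ≤ t := hη0.trans hηt
      push Not at h2
      have := mul_le_mul_of_nonneg_left h2 this
      linarith
    · rw [zero_sub, mul_neg, mul_one, Left.neg_nonpos_iff]; positivity
    · simp
  have h3 := expect_mono hq hpt
  rw [expect_const_mul, expect_sub] at h3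
  refine le_trans ?_ h3
  have h4 : Real.exp (μ * (t * (Real.exp (-t) - η) - (1 - Real.exp (-t)) -
        (1 - Real.exp (-t)) ^ 2 * r)) = K *
      Real.exp (-((1 - Real.exp (-t)) * μ + (1 - Real.exp (-t)) ^ 2 * r * μ)) := by
    rw [hK, ← Real.exp_add]; ring_nf
  rw [h4, mul_left_comm]
  refine mul_le_mul_of_nonneg_left ?_ (Real.exp_pos _).le
  calc _ ≤ (c - Real.exp (-(η ^ 2 / 8 * μ))) * Z := mul_le_mul_of_nonneg_left hZ (by linarith)
    _ ≤ _ := by linarith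

/-! ### Tilted probabilities of lower tail events -/

lemma expect_mul_ind_not (f : Finset ι → ℝ) (D : Finset ι → Prop) :
    (expect q fun S => f S * ind (D S)) =
      expect q f - expect q fun S => f S * ind (¬ D S) := by
  rw [← expect_sub]
  refine congrArg _ (funext fun S => ?_)
  by_cases h : D S <;> simp [ind, h]

/-- The tilted probability of the lower tail event of the very count that defines the tilt. -/
lemma tilted_lower_tail_self (hq : ∀ i, q i ∈ Set.Icc (0 : ℝ) 1) {t η r d : ℝ}
    (hη0 : 0 ≤ η) (hη1 : η ≤ 1) (hηt : η ≤ t)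
    (hr : r ≤ 1 / 2) (hAr : ∀ b ∈ s, pr q (A b) ≤ r)
    (hμ : 0 < mean q s A) (hA : ∀ a ∈ s, (A a).Nonempty) (hd0 : 0 ≤ d) (hd : d ≤ 1)
    (hΛ : corr q s A ≤ (1 + d) * mean q s A)
    (herr : 2 * d * (t + η) ^ 2 + (1 - Real.exp (-t)) ^ 2 * r ≤ η ^ 2 / 8) :
    (1 - Real.exp (-(η ^ 2 / 8 * mean q s A))) *
        (expect q fun S => Real.exp (-(t * count s A S))) ≤
      expect q fun S => Real.exp (-(t * count s A S)) *
        ind (count s A S ≤ (Real.exp (-t) + η) * mean q s A) := by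
  have h := tilted_tail_le hq hη0 hη1 hηt (Or.inr rfl) hr hAr hμ hA hd0 hd hΛ herr
  rw [expect_mul_ind_not]
  have h2 : ∀ S, (-1 * (count s A S - Real.exp (-t) * mean q s A) < -(η * mean q s A)) ↔
      ¬ count s A S ≤ (Real.exp (-t) + η) * mean q s A := by
    intro S
    rw [not_le]
    constructor <;> intro h <;> linarith
  simp only [h2] at h
  linarith

/-- Under the tilt by a count `X`, the mean of a second count `Y`, each of whose members contains a
member counted by `X`, is at most about `exp (-t)` times its original mean: the presence of a
member of `Y` costs a factor `exp (-t)`, and it influences few other terms of `X`. -/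
lemma expect_count_mul_exp_le (hq : ∀ i, q i ∈ Set.Icc (0 : ℝ) 1) {t θ : ℝ} (ht : 0 ≤ t)
    (hA : ∀ a ∈ s, (A a).Nonempty) (hsub : ∀ b ∈ s', ∃ a ∈ s, A a ⊆ B b)
    (hθ : ∀ b ∈ s', mean q (s.filter fun a => ¬ Disjoint (B b) (A a)) A ≤ θ) :
    (expect q fun S => count s' B S * Real.exp (-(t * count s A S))) ≤
      Real.exp (-t) * Real.exp (t * θ) * mean q s' B *
        expect q fun S => Real.exp (-(t * count s A S)) := by
  set Z := expect q fun S => Real.exp (-(t * count s A S))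
  have hterm : ∀ b ∈ s', (expect q fun S => incl (B b) S * Real.exp (-(t * count s A S))) ≤
      pr q (B b) * (Real.exp (-t) * Real.exp (t * θ) * Z) := by
    intro b hb
    rw [expect_incl_mul (B b) fun S => Real.exp (-(t * count s A S))]
    refine mul_le_mul_of_nonneg_left ?_ (pr_nonneg hq _)
    obtain ⟨a, ha, hab⟩ := hsub b hb
    have hone : ∀ S, 1 ≤ count (s.filter fun a => ¬ Disjoint (B b) (A a)) A (S ∪ B b) := by
      intro S
      have hmem : a ∈ s.filter fun a => ¬ Disjoint (B b) (A a) := by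
        refine Finset.mem_filter.2 ⟨ha, fun h => (hA a ha).ne_empty ?_⟩
        exact Finset.disjoint_self_iff_empty _ |>.1 (h.mono_left hab)
      calc (1 : ℝ) = incl (A a) (S ∪ B b) := by
            simp [incl, hab.trans Finset.subset_union_right]
        _ ≤ _ := Finset.single_le_sum (f := fun a => incl (A a) (S ∪ B b))
          (fun _ _ => incl_nonneg _ _) hmem
    set R : Finset ι → ℝ := count (s.filter fun a => Disjoint (B b) (A a)) A with hR
    set R' : Finset ι → ℝ := count (s.filter fun a => ¬ Disjoint (B b) (A a)) A with hR'
    have h1 : (expect q fun S => Real.exp (-(t * count s A (S ∪ B b)))) ≤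
        Real.exp (-t) * expect q fun S => Real.exp (-(t * R S)) := by
      rw [← expect_const_mul]
      refine expect_mono hq fun S => ?_
      rw [← Real.exp_add, Real.exp_le_exp, count_union (B b) S]
      have := mul_le_mul_of_nonneg_left (hone S) ht
      linarith
    have h2 : (expect q fun S => Real.exp (-(t * R S))) * Real.exp (-(t * θ)) ≤ Z := by
      have h3 : Real.exp (-(t * θ)) ≤ expect q fun S => Real.exp (-(t * R' S)) := by
        refine le_trans (Real.exp_le_exp.2 ?_) (exp_expect_le hq _)
        simp only [← neg_mul]
        rw [expect_const_mul, hR', expect_count]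
        have := mul_le_mul_of_nonneg_left (hθ b hb) ht
        linarith
      refine (mul_le_mul_of_nonneg_left h3 (expect_exp_pos hq).le).trans ?_
      refine (expect_mul_expect_le hq (antitone_exp_neg_count ht _ A)
        (antitone_exp_neg_count ht _ A) (fun S => (Real.exp_pos _).le)
        fun S => (Real.exp_pos _).le).trans (le_of_eq ?_)
      refine congrArg _ (funext fun S => ?_)
      rw [← Real.exp_add, count_eq_filter_add (s := s) (A := A) (B b) S]
      ring_nf
    have h4 : (expect q fun S => Real.exp (-(t * R S))) ≤ Real.exp (t * θ) * Z := by
      have h5 := mul_le_mul_of_nonneg_left h2 (Real.exp_pos (t * θ)).le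
      refine le_trans (le_of_eq ?_) h5
      rw [mul_left_comm, ← Real.exp_add]
      simp
    refine h1.trans ?_
    rw [mul_assoc]
    exact mul_le_mul_of_nonneg_left h4 (Real.exp_pos _).le
  have hsum : expect q (fun S => count s' B S * Real.exp (-(t * count s A S))) =
      ∑ b ∈ s', expect q fun S => incl (B b) S * Real.exp (-(t * count s A S)) := by
    rw [← expect_sum]
    refine congrArg _ (funext fun S => ?_)
    rw [count, Finset.sum_mul]
  rw [hsum]
  refine (Finset.sum_le_sum hterm).trans (le_of_eq ?_)
  rw [← Finset.sum_mul, ← mean]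
  ring

/-- Markov's inequality under the tilted measure. -/
lemma tilted_lower_tail_markov (hq : ∀ i, q i ∈ Set.Icc (0 : ℝ) 1) {t θ ε c : ℝ} (ht : 0 ≤ t)
    (hA : ∀ a ∈ s, (A a).Nonempty) (hsub : ∀ b ∈ s', ∃ a ∈ s, A a ⊆ B b)
    (hθ : ∀ b ∈ s', mean q (s.filter fun a => ¬ Disjoint (B b) (A a)) A ≤ θ)
    (hν : 0 < mean q s' B) (hε : ε < 1)
    (hc : Real.exp (-t) * Real.exp (t * θ) ≤ (1 - ε) * (1 - c)) :
    c * (expect q fun S => Real.exp (-(t * count s A S))) ≤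
      expect q fun S => Real.exp (-(t * count s A S)) *
        ind (count s' B S ≤ (1 - ε) * mean q s' B) := by
  have h := expect_count_mul_exp_le hq ht hA hsub hθ
  set ν := mean q s' B
  set Z := expect q fun S => Real.exp (-(t * count s A S))
  have hZ : 0 < Z := expect_exp_pos hq
  have hb : 0 < (1 - ε) * ν := mul_pos (by linarith) hν
  have h1 : ∀ S, ((1 - ε) * ν) * (Real.exp (-(t * count s A S)) *
      ind (¬ count s' B S ≤ (1 - ε) * ν)) ≤
      count s' B S * Real.exp (-(t * count s A S)) := by
    intro S
    by_cases hS : count s' B S ≤ (1 - ε) * ν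
    · rw [ind_of_false (not_not.2 hS), mul_zero, mul_zero]
      exact mul_nonneg (count_nonneg S) (Real.exp_pos _).le
    · rw [ind_of_true hS, mul_one]
      rw [not_le] at hS
      exact mul_le_mul_of_nonneg_right hS.le (Real.exp_pos _).le
  have h2 := expect_mono hq h1
  rw [expect_const_mul] at h2
  rw [expect_mul_ind_not]
  set V := expect q fun S => Real.exp (-(t * count s A S)) *
      ind (¬ count s' B S ≤ (1 - ε) * ν)
  have h3 : ((1 - ε) * ν) * V ≤ ((1 - ε) * ν) * ((1 - c) * Z) := by
    refine h2.trans (h.trans ?_)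
    have := mul_le_mul_of_nonneg_right hc (mul_nonneg hν.le hZ.le)
    linarith
  have h4 := le_of_mul_le_mul_left h3 hb
  change c * Z ≤ Z - V
  linarith

/-! ### Tilting by the number of elements -/

/-- The element probabilities after the tilt by `exp (-t * card)`. -/
def tiltProb (t : ℝ) (q : ι → ℝ) (i : ι) : ℝ := q i * Real.exp (-t) / (1 - q i + q i * Real.exp (-t))

lemma tiltProb_denom_pos (hq : ∀ i, q i ∈ Set.Icc (0 : ℝ) 1) (t : ℝ) (i : ι) :
    0 < 1 - q i + q i * Real.exp (-t) := by
  have h := hq i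
  have h0 := Real.exp_pos (-t)
  rcases eq_or_lt_of_le h.2 with h1 | h1
  · rw [h1]; linarith
  · have := mul_nonneg h.1 h0.le
    linarith

lemma tiltProb_mem_Icc (hq : ∀ i, q i ∈ Set.Icc (0 : ℝ) 1) (t : ℝ) (i : ι) :
    tiltProb t q i ∈ Set.Icc (0 : ℝ) 1 := by
  have h := hq i
  have hd := tiltProb_denom_pos hq t i
  refine ⟨div_nonneg (mul_nonneg h.1 (Real.exp_pos _).le) hd.le, ?_⟩
  rw [tiltProb, div_le_one hd]
  linarith [h.2]

lemma weight_mul_exp_neg_card (hq : ∀ i, q i ∈ Set.Icc (0 : ℝ) 1) (t : ℝ) (S : Finset ι) :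
    weight q S * Real.exp (-(t * S.card)) =
      (∏ i, (1 - q i + q i * Real.exp (-t))) * weight (tiltProb t q) S := by
  have h1 : Real.exp (-(t * S.card)) = ∏ i, if i ∈ S then Real.exp (-t) else 1 := by
    rw [Finset.prod_ite_mem, Finset.univ_inter, Finset.prod_const, ← Real.exp_nat_mul]
    ring_nf
  rw [h1, weight, weight, ← Finset.prod_mul_distrib, ← Finset.prod_mul_distrib]
  refine Finset.prod_congr rfl fun i _ => ?_
  have hd := (tiltProb_denom_pos hq t i).ne'
  unfold tiltProb
  split_ifs
  · field_simp
  · field_simp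
    ring

/-- If the count is almost surely the number of elements, the tilted measure is again a product
measure. -/
lemma expect_exp_neg_mul_eq (hq : ∀ i, q i ∈ Set.Icc (0 : ℝ) 1) (t : ℝ)
    (hcard : ∀ S, weight q S ≠ 0 → count s A S = S.card) (f : Finset ι → ℝ) :
    (expect q fun S => Real.exp (-(t * count s A S)) * f S) =
      (expect q fun S => Real.exp (-(t * count s A S))) * expect (tiltProb t q) f := by
  have h1 : ∀ S, weight q S * Real.exp (-(t * count s A S)) =
      (∏ i, (1 - q i + q i * Real.exp (-t))) * weight (tiltProb t q) S := by
    intro S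
    rw [← weight_mul_exp_neg_card hq]
    by_cases h : weight q S = 0
    · simp [h]
    · rw [hcard S h]
  have h2 : (expect q fun S => Real.exp (-(t * count s A S))) =
      ∏ i, (1 - q i + q i * Real.exp (-t)) := by
    rw [expect, Finset.sum_congr rfl fun S _ => h1 S, ← Finset.mul_sum, sum_weight, mul_one]
  rw [h2, expect, expect, Finset.mul_sum]
  refine Finset.sum_congr rfl fun S _ => ?_
  rw [← mul_assoc, h1, mul_assoc]

/-- The variance of a count is at most `corr`. -/
lemma expect_count_sub_mean_sq_le (hq : ∀ i, q i ∈ Set.Icc (0 : ℝ) 1) :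
    (expect q fun S => (count s A S - mean q s A) ^ 2) ≤ corr q s A := by
  have h1 : ∀ S, (count s A S - mean q s A) ^ 2 =
      (∑ a ∈ s, ∑ b ∈ s, incl (A a ∪ A b) S) - 2 * mean q s A * count s A S + mean q s A ^ 2 := by
    intro S
    have : ∑ a ∈ s, ∑ b ∈ s, incl (A a ∪ A b) S = count s A S * count s A S := by
      simp only [← incl_mul_incl, count, Finset.sum_mul_sum]
    rw [this]; ring
  have h2 : (expect q fun S => ∑ a ∈ s, ∑ b ∈ s, incl (A a ∪ A b) S) =
      ∑ a ∈ s, ∑ b ∈ s, pr q (A a ∪ A b) := by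
    rw [expect_sum]
    refine Finset.sum_congr rfl fun a _ => ?_
    rw [expect_sum]
    exact Finset.sum_congr rfl fun b _ => expect_incl _
  have h3 : ∑ a ∈ s, ∑ b ∈ s, pr q (A a ∪ A b) ≤ corr q s A + mean q s A ^ 2 := by
    rw [sq, mean, Finset.sum_mul_sum, corr, ← Finset.sum_add_distrib]
    refine Finset.sum_le_sum fun a _ => ?_
    rw [← Finset.sum_filter_add_sum_filter_not s fun b => ¬ Disjoint (A a) (A b)]
    refine add_le_add le_rfl ?_
    simp only [not_not]
    calc ∑ b ∈ s with Disjoint (A a) (A b), pr q (A a ∪ A b)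
        = ∑ b ∈ s with Disjoint (A a) (A b), pr q (A a) * pr q (A b) :=
          Finset.sum_congr rfl fun b hb => Finset.prod_union (Finset.mem_filter.1 hb).2
      _ ≤ _ := Finset.sum_le_sum_of_subset_of_nonneg (Finset.filter_subset _ _)
          fun b _ _ => mul_nonneg (pr_nonneg hq _) (pr_nonneg hq _)
  simp only [h1]
  rw [expect_add, expect_sub, expect_const, expect_const_mul, expect_count, h2]
  linarith

/-- Chebyshev's inequality under the tilted measure, when the latter is a product measure. -/
lemma tilted_lower_tail_chebyshev (hq : ∀ i, q i ∈ Set.Icc (0 : ℝ) 1) {t r ε η : ℝ} (ht : 0 ≤ t)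
    (hcard : ∀ S, weight q S ≠ 0 → count s A S = S.card)
    (hqr : ∀ i, q i ≤ r) (hr1 : r < 1) (hB : ∀ b ∈ s', (B b).Nonempty)
    (hν : 0 < mean q s' B) (hη : 0 < η)
    (hε : Real.exp (-t) ≤ (1 - ε - η) * (1 - r * (1 - Real.exp (-t)))) :
    (1 - corr q s' B / (η * mean q s' B) ^ 2) *
        (expect q fun S => Real.exp (-(t * count s A S))) ≤
      expect q fun S => Real.exp (-(t * count s A S)) *
        ind (count s' B S ≤ (1 - ε) * mean q s' B) := by
  rw [expect_exp_neg_mul_eq hq t hcard, mul_comm]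
  refine mul_le_mul_of_nonneg_left ?_ (expect_exp_pos hq).le
  have hq' := tiltProb_mem_Icc hq t
  set q' := tiltProb t q with hq'def
  set ν := mean q s' B
  have hE1 : Real.exp (-t) ≤ 1 := Real.exp_le_one_iff.2 (by linarith)
  have hE0 := Real.exp_pos (-t)
  have hle : ∀ i, q' i ≤ q i := fun i => by
    rw [hq'def, tiltProb, div_le_iff₀ (tiltProb_denom_pos hq t i)]
    have h := hq i
    have := mul_nonneg (mul_nonneg h.1 (sub_nonneg.2 h.2)) (sub_nonneg.2 hE1)
    linarith
  have hden : 0 < 1 - r * (1 - Real.exp (-t)) := by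
    nlinarith
  set ρ := 1 - ε - η
  have hρ : ∀ i, q' i ≤ ρ * q i := fun i => by
    rw [hq'def, tiltProb, div_le_iff₀ (tiltProb_denom_pos hq t i)]
    have h := hq i
    have hρ0 : 0 ≤ ρ := by
      by_contra hcon
      push Not at hcon
      have := mul_neg_of_neg_of_pos hcon hden
      linarith
    have h1 : 1 - r * (1 - Real.exp (-t)) ≤ 1 - q i + q i * Real.exp (-t) := by
      have := mul_le_mul_of_nonneg_right (hqr i) (sub_nonneg.2 hE1)
      linarith
    have h2 := hε.trans (mul_le_mul_of_nonneg_left h1 hρ0)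
    have := mul_le_mul_of_nonneg_left h2 h.1
    linarith
  have hpr : ∀ B : Finset ι, pr q' B ≤ pr q B := fun B =>
    Finset.prod_le_prod (fun i _ => (hq' i).1) fun i _ => hle i
  have hmean : mean q' s' B ≤ ρ * ν := by
    rw [mean, show ν = mean q s' B from rfl, mean, Finset.mul_sum]
    refine Finset.sum_le_sum fun b hb => ?_
    obtain ⟨i, hi⟩ := hB b hb
    rw [pr, pr, ← Finset.mul_prod_erase _ _ hi, ← Finset.mul_prod_erase _ _ hi, ← mul_assoc]
    exact mul_le_mul (hρ i) (hpr _) (pr_nonneg hq' _) ((hq' i).1.trans (hρ i))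
  have hcorr : corr q' s' B ≤ corr q s' B :=
    Finset.sum_le_sum fun a _ => Finset.sum_le_sum fun b _ => hpr _
  have hvar := (expect_count_sub_mean_sq_le (s := s') (A := B) hq').trans hcorr
  have h1 : ∀ S, 1 - (count s' B S - mean q' s' B) ^ 2 / (η * ν) ^ 2 ≤
      ind (count s' B S ≤ (1 - ε) * ν) := by
    intro S
    unfold ind
    split_ifs with hS
    · have : 0 ≤ (count s' B S - mean q' s' B) ^ 2 / (η * ν) ^ 2 := by positivity
      linarith
    · rw [not_le] at hS
      rw [sub_nonpos, one_le_div (by positivity)]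
      refine pow_le_pow_left₀ (by positivity) ?_ 2
      have : ρ * ν = (1 - ε) * ν - η * ν := by ring
      linarith
  refine le_trans ?_ (expect_mono hq' h1)
  have h2 : ∀ S, (count s' B S - mean q' s' B) ^ 2 / (η * ν) ^ 2 =
      ((η * ν) ^ 2)⁻¹ * (count s' B S - mean q' s' B) ^ 2 := fun S => by
    rw [div_eq_inv_mul]
  simp only [h2]
  rw [expect_sub, expect_const, expect_const_mul, div_eq_inv_mul]
  have := mul_le_mul_of_nonneg_left hvar (a := ((η * ν) ^ 2)⁻¹) (by positivity)
  linarith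

end Bounds

/-! ### The rate function and the choice of the tilt -/

lemma sq_div_four_le_phi_neg {ε : ℝ} (hε : ε ∈ Set.Ioc (0 : ℝ) 1) : ε ^ 2 / 4 ≤ phi (-ε) := by
  rcases eq_or_lt_of_le hε.2 with rfl | h1
  · simp [phi]; norm_num
  · have hy : 0 < 1 - ε := by linarith
    set x := Real.sqrt (1 - ε) with hx
    have hx0 : 0 < x := Real.sqrt_pos.2 hy
    have hxy : x ^ 2 = 1 - ε := Real.sq_sqrt hy.le
    have hlog : 2 * (1 - x⁻¹) ≤ Real.log (1 - ε) := by
      rw [← hxy, Real.log_pow]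
      have := Real.one_sub_inv_le_log_of_pos hx0
      push_cast
      linarith
    have h2 : x ^ 2 * (2 * (1 - x⁻¹)) ≤ x ^ 2 * Real.log (1 - ε) :=
      mul_le_mul_of_nonneg_left hlog (sq_nonneg x)
    have h3 : x ^ 2 * (2 * (1 - x⁻¹)) = 2 * x ^ 2 - 2 * x := by field_simp
    have h4 : phi (-ε) = x ^ 2 * Real.log (1 - ε) + ε := by
      rw [phi, hxy]; ring_nf
    have h5 : (1 - x) ^ 2 ≤ phi (-ε) := by
      have : ε = 1 - x ^ 2 := by linarith
      rw [h4]; nlinarith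
    have h6 : ε ^ 2 = (1 - x) ^ 2 * (1 + x) ^ 2 := by
      have : ε = 1 - x ^ 2 := by linarith
      rw [this]; ring
    have h7 : x ≤ 1 := by nlinarith [hε.1]
    have h8 : (1 + x) ^ 2 ≤ 4 := by nlinarith
    nlinarith [mul_le_mul_of_nonneg_left h8 (sq_nonneg (1 - x))]

/-- The tilting parameter for which the tilted mean is `1 - a` times the original mean. -/
def tiltParam (a : ℝ) : ℝ := -Real.log (1 - a)

section Tilt

variable {ε η γ : ℝ}

lemma tilt_bounds (hε : 0 < ε) (hη : 0 < η) (hεη : ε ≤ 1 - η) (hγ : 0 < γ) (hγη : γ ≤ η / 2) :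
    (1 + γ) * ε ≤ 2 * ε ∧ Real.exp (-tiltParam ((1 + γ) * ε)) = 1 - (1 + γ) * ε ∧
      ε ≤ tiltParam ((1 + γ) * ε) ∧ tiltParam ((1 + γ) * ε) ≤ 4 * ε / η := by
  have ha2 : (1 + γ) * ε ≤ 2 * ε := mul_le_mul_of_nonneg_right (by linarith) hε.le
  have ha1 : (1 + γ) * ε ≤ 1 - η / 2 := by nlinarith
  have haε : ε ≤ (1 + γ) * ε := by nlinarith
  set a := (1 + γ) * ε
  have hpos : 0 < 1 - a := by linarith
  refine ⟨ha2, ?_, ?_, ?_⟩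
  · rw [tiltParam, neg_neg, Real.exp_log hpos]
  · have := Real.log_le_sub_one_of_pos hpos
    rw [tiltParam]; linarith
  · have h1 := Real.one_sub_inv_le_log_of_pos hpos
    have h2 : (1 - a)⁻¹ - 1 = a / (1 - a) := by field_simp; ring
    have h3 : a / (1 - a) ≤ 2 * ε / (η / 2) :=
      div_le_div₀ (by linarith) ha2 (by linarith) (by linarith)
    have h4 : 2 * ε / (η / 2) = 4 * ε / η := by field_simp; norm_num
    rw [tiltParam]
    linarith

/-- Convexity of the rate function, at the point `a ≥ ε`. -/
lemma phi_neg_le_add (hε : ε < 1) {a : ℝ} (ha : a < 1) :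
    phi (-a) ≤ phi (-ε) + tiltParam a * (a - ε) := by
  have h1 : 0 < 1 - ε := by linarith
  have h2 : 0 < 1 - a := by linarith
  have h3 := Real.log_le_sub_one_of_pos (div_pos h2 h1)
  rw [Real.log_div h2.ne' h1.ne'] at h3
  have h4 := mul_le_mul_of_nonneg_left h3 h1.le
  have h5 : (1 - ε) * ((1 - a) / (1 - ε) - 1) = ε - a := by field_simp; ring
  rw [h5] at h4
  simp only [phi, tiltParam, ← sub_eq_add_neg]
  linarith

end Tilt

section LowerBound

open scoped Classical

variable {ι κ κ' : Type*} [Fintype ι] [DecidableEq ι] {q : ι → ℝ}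
  {s : Finset κ} {A : κ → Finset ι} {s' : Finset κ'} {B : κ' → Finset ι}
  {ε η γ r d : ℝ}

/-- The error terms of the Laplace transform are negligible against the squared width `γ * ε` of
the window. -/
lemma tilt_error_le (hε : 0 < ε) (hη : 0 < η) (hεη : ε ≤ 1 - η) (hγ : 0 < γ) (hγη : γ ≤ η / 2)
    (hr0 : 0 ≤ r) (hr : r ≤ γ ^ 2 / 64) (hd : d ≤ γ ^ 2 * η ^ 2 / 800) :
    2 * d * (tiltParam ((1 + γ) * ε) + γ * ε) ^ 2 +
      (1 - Real.exp (-tiltParam ((1 + γ) * ε))) ^ 2 * r ≤ (γ * ε) ^ 2 / 8 := by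
  obtain ⟨ha, he, ht0, ht⟩ := tilt_bounds hε hη hεη hγ hγη
  have haε : 0 ≤ (1 + γ) * ε := by positivity
  have h1 : tiltParam ((1 + γ) * ε) + γ * ε ≤ 5 * ε / η := by
    have h2 : γ * ε ≤ ε / η := by
      rw [le_div_iff₀ hη]
      have : γ * η ≤ 1 := by nlinarith
      nlinarith
    calc _ ≤ 4 * ε / η + ε / η := add_le_add ht h2
      _ = _ := by ring
  have h3 : (tiltParam ((1 + γ) * ε) + γ * ε) ^ 2 ≤ 25 * ε ^ 2 / η ^ 2 := by
    refine (pow_le_pow_left₀ (add_nonneg (hε.le.trans ht0) (by positivity)) h1 2).trans (le_of_eq ?_)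
    field_simp; norm_num
  rw [he, sub_sub_cancel]
  have h4 : ((1 + γ) * ε) ^ 2 ≤ 4 * ε ^ 2 := by
    refine (pow_le_pow_left₀ haε ha 2).trans (le_of_eq ?_); ring
  have h5 : 2 * d * (tiltParam ((1 + γ) * ε) + γ * ε) ^ 2 ≤ (γ * ε) ^ 2 / 16 := by
    calc _ ≤ 2 * (γ ^ 2 * η ^ 2 / 800) * (25 * ε ^ 2 / η ^ 2) :=
          mul_le_mul (by linarith) h3 (sq_nonneg _) (by positivity)
      _ = _ := by field_simp; norm_num
  have h6 : ((1 + γ) * ε) ^ 2 * r ≤ (γ * ε) ^ 2 / 16 := by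
    calc _ ≤ (4 * ε ^ 2) * (γ ^ 2 / 64) := mul_le_mul h4 hr hr0 (by positivity)
      _ = _ := by ring
  linarith

/-- The lower bound by change of measure, with the error terms absorbed: it remains to show that
the tilted probability `u` of the event is not too small. -/
lemma exp_le_prob_of_tilted (hq : ∀ i, q i ∈ Set.Icc (0 : ℝ) 1) {c u : ℝ} (hc : 0 < c)
    (hε : 0 < ε) (hη : 0 < η) (hεη : ε ≤ 1 - η) (hγ : 0 < γ) (hγη : γ ≤ η / 2)
    (hγc : γ ≤ c * η / 256) (hr0 : 0 ≤ r) (hr : r ≤ γ ^ 2 / 64) (hrc : r ≤ c / 128)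
    (hd0 : 0 ≤ d) (hd : d ≤ γ ^ 2 * η ^ 2 / 800)
    (hAr : ∀ b ∈ s, pr q (A b) ≤ r)
    (hμ : 0 < mean q s A) (hA : ∀ a ∈ s, (A a).Nonempty)
    (hΛ : corr q s A ≤ (1 + d) * mean q s A) {D : Finset ι → Prop}
    (hu1 : Real.exp (-(γ ^ 2 / 8 * (ε ^ 2 * mean q s A))) ≤ u / 2)
    (hu2 : Real.exp (-(c / 16 * (ε ^ 2 * mean q s A))) ≤ u / 2)
    (hD : u * (expect q fun S => Real.exp (-(tiltParam ((1 + γ) * ε) * count s A S))) ≤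
      expect q fun S => Real.exp (-(tiltParam ((1 + γ) * ε) * count s A S)) * ind (D S)) :
    Real.exp (-((1 + c) * (phi (-ε) * mean q s A))) ≤ prob q D := by
  obtain ⟨ha, he, ht0, ht⟩ := tilt_bounds hε hη hεη hγ hγη
  have herr := tilt_error_le hε hη hεη hγ hγη hr0 hr hd
  have hη1 : η < 1 := by linarith
  have hγ1 : γ ≤ 1 := by linarith
  have hγ2 : γ ^ 2 ≤ 1 := pow_le_one₀ hγ.le hγ1
  have hη2 : η ^ 2 ≤ 1 := pow_le_one₀ hη.le hη1.le
  have hw : γ * ε ≤ ε := mul_le_of_le_one_left hε.le hγ1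
  have hd1 : d ≤ 1 := by nlinarith [sq_nonneg γ, sq_nonneg η]
  have hgm : (γ * ε) ^ 2 / 8 * mean q s A = γ ^ 2 / 8 * (ε ^ 2 * mean q s A) := by ring
  have h := le_prob_of_tilted hq (t := tiltParam ((1 + γ) * ε)) (η := γ * ε) (c := u) (D := D)
    (by positivity) (by linarith) (by linarith) (by linarith) hAr hμ hA hd0 hd1 hΛ herr
    (by rw [hgm]; linarith [Real.exp_pos (-(γ ^ 2 / 8 * (ε ^ 2 * mean q s A)))]) hD
  rw [hgm] at h
  set μ := mean q s A
  set t := tiltParam ((1 + γ) * ε) with htdef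
  set a := (1 + γ) * ε with hadef
  refine le_trans ?_ h
  have hphi := sq_div_four_le_phi_neg (ε := ε) ⟨hε, by linarith⟩
  have h1 : Real.exp (-(c / 16 * (ε ^ 2 * μ))) ≤ u - Real.exp (-(γ ^ 2 / 8 * (ε ^ 2 * μ))) := by
    linarith
  refine le_trans ?_ (mul_le_mul_of_nonneg_right h1 (Real.exp_pos _).le)
  rw [← Real.exp_add, Real.exp_le_exp, he]
  have ha1 : a < 1 := by
    have := Real.exp_pos (-t)
    linarith
  have hconv := phi_neg_le_add (ε := ε) (by linarith) ha1
  have hpa : phi (-a) = a - (1 - a) * t := by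
    rw [phi, htdef, tiltParam, ← sub_eq_add_neg]; ring
  have hexp : t * (1 - a - γ * ε) - (1 - (1 - a)) - (1 - (1 - a)) ^ 2 * r =
      -phi (-a) - t * (γ * ε) - a ^ 2 * r := by rw [hpa]; ring
  have haε : a - ε = γ * ε := by rw [hadef]; ring
  rw [← htdef, haε] at hconv
  -- the cost of the width of the window
  have h2 : t * (γ * ε) ≤ c / 16 * phi (-ε) := by
    calc t * (γ * ε) ≤ (4 * ε / η) * ((c * η / 256) * ε) :=
          mul_le_mul ht (mul_le_mul_of_nonneg_right hγc hε.le) (by positivity) (by positivity)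
      _ = c / 16 * (ε ^ 2 / 4) := by field_simp; norm_num
      _ ≤ _ := mul_le_mul_of_nonneg_left hphi (by positivity)
  have h3 : a ^ 2 * r ≤ c / 8 * phi (-ε) := by
    have ha0 : 0 ≤ a := by positivity
    calc a ^ 2 * r ≤ (2 * ε) ^ 2 * (c / 128) :=
          mul_le_mul (pow_le_pow_left₀ ha0 ha 2) hrc hr0 (by positivity)
      _ = c / 8 * (ε ^ 2 / 4) := by ring
      _ ≤ _ := mul_le_mul_of_nonneg_left hphi (by positivity)
  have h4 : c / 16 * ε ^ 2 ≤ c / 4 * phi (-ε) := by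
    have := mul_le_mul_of_nonneg_left hphi (show 0 ≤ c / 4 by positivity)
    linarith
  have h0 : 0 ≤ c * phi (-ε) := mul_nonneg hc.le ((by positivity : 0 ≤ ε ^ 2 / 4).trans hphi)
  rw [hexp]
  have h5 : c / 16 * ε ^ 2 + (phi (-a) + t * (γ * ε) + a ^ 2 * r) ≤ (1 + c) * phi (-ε) := by
    linarith
  have h6 := mul_le_mul_of_nonneg_right h5 hμ.le
  linarith

/-- The exponent condition of `tilted_lower_tail_markov`. -/
lemma tilt_markov_condition (hε : 0 < ε) (hη : 0 < η) (hεη : ε ≤ 1 - η) (hγ : 0 < γ)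
    (hγη : γ ≤ η / 2) {θ : ℝ} (hθ0 : 0 ≤ θ) (hθ : θ ≤ γ * η / 16) :
    Real.exp (-tiltParam ((1 + γ) * ε)) * Real.exp (tiltParam ((1 + γ) * ε) * θ) ≤
      (1 - ε) * (1 - γ * ε / 2) := by
  obtain ⟨ha, he, ht0, ht⟩ := tilt_bounds hε hη hεη hγ hγη
  have he0 := Real.exp_pos (-tiltParam ((1 + γ) * ε))
  set t := tiltParam ((1 + γ) * ε)
  have h1 : t * θ ≤ γ * ε / 4 := by
    calc t * θ ≤ (4 * ε / η) * (γ * η / 16) := mul_le_mul ht hθ hθ0 (by positivity)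
      _ = _ := by field_simp; norm_num
  have h0 : 0 ≤ t * θ := mul_nonneg (hε.le.trans ht0) hθ0
  have hγε : γ * ε ≤ 1 := by nlinarith
  have h2 : Real.exp (t * θ) ≤ 1 + γ * ε / 2 := by
    have h3 := Real.abs_exp_sub_one_le (x := t * θ) (by rw [abs_of_nonneg h0]; linarith)
    rw [abs_of_nonneg h0] at h3
    linarith [le_abs_self (Real.exp (t * θ) - 1)]
  rw [he] at he0 ⊢
  have hp : 0 < γ * ε := by positivity
  calc _ ≤ (1 - (1 + γ) * ε) * (1 + γ * ε / 2) := mul_le_mul_of_nonneg_left h2 he0.le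
    _ ≤ _ := by nlinarith [mul_pos hp hε, mul_pos hp hp]

/-- The condition of `tilted_lower_tail_chebyshev` on the tilted element probabilities. -/
lemma tilt_chebyshev_condition (hε : 0 < ε) (hη : 0 < η) (hεη : ε ≤ 1 - η) (hγ : 0 < γ)
    (hγη : γ ≤ η / 2) (hr0 : 0 ≤ r) (hr : r ≤ γ / 4) :
    Real.exp (-tiltParam ((1 + γ) * ε)) ≤
      (1 - ε - γ * ε / 2) * (1 - r * (1 - Real.exp (-tiltParam ((1 + γ) * ε)))) := by
  obtain ⟨ha, he, ht0, ht⟩ := tilt_bounds hε hη hεη hγ hγη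
  rw [he, sub_sub_cancel]
  have h1 : 0 ≤ r * ((1 + γ) * ε) := by positivity
  have h2 : r * ((1 + γ) * ε) ≤ γ * ε / 2 := by
    calc _ ≤ γ / 4 * (2 * ε) := mul_le_mul hr ha (by positivity) (by positivity)
      _ = _ := by ring
  have h3 : 0 ≤ (ε + γ * ε / 2) * (r * ((1 + γ) * ε)) := by positivity
  linarith

end LowerBound

/-! ### Asymptotics of the second moments -/

section Asymptotic

open scoped Classical

variable {α : Type*} {k : ℕ} {G H : Hypergraph α} {p : ℕ → unitInterval}

lemma edgeSet_finite (hH : IsKGraph k H) : H.edgeSet.Finite :=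
  hH.1.finite_subsets.subset fun _ he => edge_subset he

lemma IsKGraph.mono (hH : IsKGraph k H) (hGH : IsSubgraph G H) : IsKGraph k G :=
  ⟨hH.1.subset hGH.1, fun e he => hH.2 e (hGH.2 he)⟩

/-- The subgraphs of `H` with at least one edge. -/
def subgraphs (hH : IsKGraph k H) : Finset (Hypergraph α) :=
  (finite_subgraphs hH.1).toFinset.filter fun J => 1 ≤ J.edgeSet.ncard

lemma mem_subgraphs (hH : IsKGraph k H) (J : Hypergraph α) :
    J ∈ subgraphs hH ↔ IsSubgraph J H ∧ 1 ≤ J.edgeSet.ncard := by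
  simp [subgraphs]

lemma edges_nonempty {β : Type*} [Finite β] [Nonempty β] {J : Hypergraph α}
    (hJ : 1 ≤ J.edgeSet.ncard) {C : Hypergraph β} (hC : C ∈ allCopies J β) : (edges C).Nonempty := by
  rw [← Finset.card_pos, card_edges_of_mem hC]
  exact hJ

lemma exists_allCopies_subgraph {β : Type*} [Finite β] [Nonempty β] (hGH : IsSubgraph G H)
    {C : Hypergraph β} (hC : C ∈ allCopies H β) : ∃ D ∈ allCopies G β, edges D ⊆ edges C := by
  obtain ⟨f, hf, rfl⟩ := (mem_allCopies.1 hC).exists_image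
  refine ⟨G.image f, mem_allCopies.2 (isIsomorphic_image G (hf.mono hGH.1)), ?_⟩
  rw [← Finset.coe_subset, coe_edges, coe_edges]
  exact (hGH.image f).2

lemma meanCopies_pos (hH : IsKGraph k H) {n : ℕ} (hn : H.vertexSet.ncard ≤ n) (hn0 : 0 < n) {x : ℝ}
    (hx : 0 < x) {J : Hypergraph α} (hJ : IsSubgraph J H) : 0 < meanCopies k x J (Fin n) := by
  have : NeZero n := ⟨hn0.ne'⟩
  rw [meanCopies_eq (hH.mono hJ).2]
  have h : (allCopies J (Fin n)).Nonempty := by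
    refine allCopies_nonempty (hH.1.subset hJ.1) ?_
    rw [Fintype.card_fin]
    exact (Set.ncard_le_ncard hJ.1 hH.1).trans hn
  have h2 : (0 : ℝ) < (allCopies J (Fin n)).card := by exact_mod_cast Finset.card_pos.2 h
  positivity

/-- Every subgraph other than `G` has many more expected copies than `G`. -/
lemma eventually_meanCopies_le (hH : IsKGraph k H)
    (hmin : ∀ J : Hypergraph α, IsSubgraph J H → J ≠ G → 1 ≤ J.edgeSet.ncard →
      (fun n => EX k G n (p n)) =o[atTop] (fun n => EX k J n (p n))) {δ : ℝ} (hδ : 0 < δ) :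
    ∀ᶠ n in atTop, ∀ J ∈ subgraphs hH, J ≠ G →
      meanCopies k (p n) G (Fin n) ≤ δ * meanCopies k (p n) J (Fin n) := by
  rw [eventually_all_finset]
  intro J hJ
  obtain ⟨hJH, hJ1⟩ := (mem_subgraphs hH J).1 hJ
  by_cases hJG : J = G
  · exact Eventually.of_forall fun n h => absurd hJG h
  · filter_upwards [(hmin J hJH hJG hJ1).bound hδ] with n hn _
    rw [EX_eq_meanCopies, EX_eq_meanCopies] at hn
    have h0 : ∀ K : Hypergraph α, 0 ≤ meanCopies k (p n) K (Fin n) := fun K =>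
      mean_nonneg (edgeProb_mem_Icc (p n).2)
    rwa [Real.norm_of_nonneg (h0 G), Real.norm_of_nonneg (h0 J)] at hn

/-- Pairs of copies of `H'` intersecting in a copy of `G` dominate the second moment: for
`G ⊆ H' ⊆ H` the sum over intersecting pairs is at most about `(E X_{H'})² / E X_G`. -/
lemma eventually_corr_le (hH : IsKGraph k H) (hGH : IsSubgraph G H) (heG : 1 ≤ G.edgeSet.ncard)
    (hunique : copies G H = {G})
    (hmin : ∀ J : Hypergraph α, IsSubgraph J H → J ≠ G → 1 ≤ J.edgeSet.ncard →
      (fun n => EX k G n (p n)) =o[atTop] (fun n => EX k J n (p n)))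
    {H' : Hypergraph α} (hGH' : IsSubgraph G H') (hH' : IsSubgraph H' H) {δ : ℝ} (hδ : 0 < δ) :
    ∀ᶠ n in atTop, 0 < (p n : ℝ) →
      corr (edgeProb k (p n)) (allCopies H' (Fin n)) edges ≤
        (1 + δ) * (meanCopies k (p n) H' (Fin n) ^ 2 / meanCopies k (p n) G (Fin n)) := by
  have hK' := hH.mono hH'
  have hcG : (copies G H').ncard = 1 := by
    have : copies G H' = {G} := by
      refine Set.Subset.antisymm ?_ ?_
      · intro C hC
        rw [← hunique]
        exact ⟨hC.1.trans hH', hC.2⟩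
      · rintro _ rfl
        exact ⟨hGH', IsIsomorphic.refl _⟩
    rw [this, Set.ncard_singleton]
  set c : ℝ := ∑ J ∈ (subgraphs hK').erase G, ((copies J H').ncard : ℝ) ^ 2 with hc
  have hc0 : 0 ≤ c := Finset.sum_nonneg fun J _ => sq_nonneg _
  filter_upwards [eventually_meanCopies_le hH hmin (show 0 < δ / (c + 1) by positivity),
    eventually_ge_atTop (max 1 H.vertexSet.ncard)] with n hn hn1 hp
  have : NeZero n := ⟨by have := le_of_max_le_left hn1; omega⟩
  have hpos : ∀ J, IsSubgraph J H → 0 < meanCopies k (p n) J (Fin n) := fun J hJ =>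
    meanCopies_pos hH (le_of_max_le_right hn1) (le_of_max_le_left hn1) hp hJ
  have hG := hpos G hGH
  refine (corr_le hp hK' (mem_subgraphs hK')).trans ?_
  rw [← Finset.add_sum_erase _ _ ((mem_subgraphs hK' G).2 ⟨hGH', heG⟩), hcG, Nat.cast_one, one_pow,
    one_mul, add_mul, one_mul]
  refine add_le_add le_rfl ?_
  set R := meanCopies k (p n) H' (Fin n) ^ 2 / meanCopies k (p n) G (Fin n) with hR
  have hR0 : 0 ≤ R := div_nonneg (sq_nonneg _) hG.le
  have hterm : ∀ J ∈ (subgraphs hK').erase G, ((copies J H').ncard : ℝ) ^ 2 *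
      (meanCopies k (p n) H' (Fin n) ^ 2 / meanCopies k (p n) J (Fin n)) ≤
      ((copies J H').ncard : ℝ) ^ 2 * (δ / (c + 1) * R) := by
    intro J hJ
    obtain ⟨hJG, hJ⟩ := Finset.mem_erase.1 hJ
    obtain ⟨hJ', hJ1⟩ := (mem_subgraphs hK' J).1 hJ
    refine mul_le_mul_of_nonneg_left ?_ (sq_nonneg _)
    have h1 := hn J ((mem_subgraphs hH J).2 ⟨hJ'.trans hH', hJ1⟩) hJG
    have hJpos := hpos J (hJ'.trans hH')
    rw [hR, ← mul_div_assoc, div_le_div_iff₀ hJpos hG]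
    have := mul_le_mul_of_nonneg_left h1 (sq_nonneg (meanCopies k (p n) H' (Fin n)))
    linarith
  refine (Finset.sum_le_sum hterm).trans ?_
  rw [← Finset.sum_mul, ← hc]
  have h2 : c * (δ / (c + 1) * R) = (c / (c + 1)) * (δ * R) := by ring
  rw [h2]
  exact mul_le_of_le_one_left (by positivity) ((div_le_one (by positivity)).2 (by linarith))

lemma pr_edges_le {n : ℕ} [NeZero n] (hG : IsKGraph k G) (heG : 1 ≤ G.edgeSet.ncard)
    {x : ℝ} (hx : x ∈ Set.Icc (0 : ℝ) 1) :
    ∀ C ∈ allCopies G (Fin n), pr (edgeProb k x) (edges C) ≤ x := by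
  intro C hC
  rw [pr_edges hG.2 hC]
  exact (pow_le_pow_of_le_one hx.1 hx.2 heG).trans (le_of_eq (pow_one x))

lemma lowerTail_eq_prob (n : ℕ) (x : unitInterval) (ε : ℝ) :
    lowerTail k H n x ε = prob (edgeProb k (x : ℝ)) fun S =>
      count (allCopies H (Fin n)) edges S ≤ (1 - ε) * meanCopies k x H (Fin n) :=
  lowerTail_eq_expect H ε

/-- Without copies of `G` there are no copies of `H`. -/
lemma prob_count_eq_zero_le_lowerTail {n : ℕ} [NeZero n] (hGH : IsSubgraph G H) (x : unitInterval)
    {ε : ℝ} (hε : ε ≤ 1) :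
    prob (edgeProb k (x : ℝ)) (fun S => count (allCopies G (Fin n)) edges S = 0) ≤
      lowerTail k H n x ε := by
  rw [lowerTail_eq_prob]
  have hq := edgeProb_mem_Icc (β := Fin n) (k := k) x.2
  refine expect_mono hq fun S => ?_
  have hnn : 0 ≤ (1 - ε) * meanCopies k x H (Fin n) :=
    mul_nonneg (by linarith) (mean_nonneg hq)
  by_cases h : count (allCopies G (Fin n)) edges S = 0
  · have h0 : count (allCopies H (Fin n)) edges S = 0 := by
      refine Finset.sum_eq_zero fun C hC => ?_
      obtain ⟨D, hD, hDC⟩ := exists_allCopies_subgraph hGH hC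
      have hD0 := (Finset.sum_eq_zero_iff_of_nonneg fun a _ => incl_nonneg _ _).1 h D hD
      unfold incl at hD0 ⊢
      split_ifs at hD0 with hDS
      · norm_num at hD0
      · rw [if_neg fun hCS => hDS (hDC.trans hCS)]
    rw [ind_of_true h, ind_of_true (h0.trans_le hnn)]
  · rw [ind_of_false h]
    exact ind_nonneg _

/-! ### The upper bound -/

/-- Janson's inequality for the copies of `H`. -/
lemma eventually_lowerTail_le (hH : IsKGraph k H) (hGH : IsSubgraph G H)
    (heG : 1 ≤ G.edgeSet.ncard) (hunique : copies G H = {G})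
    (hmin : ∀ J : Hypergraph α, IsSubgraph J H → J ≠ G → 1 ≤ J.edgeSet.ncard →
      (fun n => EX k G n (p n)) =o[atTop] (fun n => EX k J n (p n)))
    {ε : ℕ → ℝ} (hε : ∀ n, ε n ∈ Set.Ioc (0 : ℝ) 1) {c : ℝ} (hc : 0 < c) :
    ∀ᶠ n in atTop, 0 < (p n : ℝ) → lowerTail k H n (p n) (ε n) ≤
      Real.exp (-((1 - c) * (phi (-ε n) * meanCopies k (p n) G (Fin n)))) := by
  have heH : 1 ≤ H.edgeSet.ncard :=
    heG.trans (Set.ncard_le_ncard hGH.2 (edgeSet_finite hH))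
  filter_upwards [eventually_corr_le hH hGH heG hunique hmin hGH (IsSubgraph.refl H) hc,
    eventually_ge_atTop (max 1 H.vertexSet.ncard)] with n hn hn1 hp
  have : NeZero n := ⟨by have := le_of_max_le_left hn1; omega⟩
  have hpos : ∀ J, IsSubgraph J H → 0 < meanCopies k (p n) J (Fin n) := fun J hJ =>
    meanCopies_pos hH (le_of_max_le_right hn1) (le_of_max_le_left hn1) hp hJ
  have hq := edgeProb_mem_Icc (β := Fin n) (k := k) (p n).2
  have hμ := hpos G hGH
  have hν := hpos H (IsSubgraph.refl H)
  have hΛ : 0 < corr (edgeProb k (p n)) (allCopies H (Fin n)) edges :=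
    hν.trans_le (mean_le_corr hq fun C hC => edges_nonempty heH hC)
  rw [lowerTail_eq_prob]
  refine (prob_count_le hq hν hΛ (hε n)).trans (Real.exp_le_exp.2 (neg_le_neg ?_))
  have hφ := (by positivity : 0 ≤ ε n ^ 2 / 4).trans (sq_div_four_le_phi_neg (hε n))
  rw [mul_left_comm]
  refine mul_le_mul_of_nonneg_left ?_ hφ
  rw [le_div_iff₀ hΛ]
  have h := hn hp
  change _ ≤ meanCopies k (p n) H (Fin n) ^ 2
  set μ := meanCopies k (p n) G (Fin n)
  set ν := meanCopies k (p n) H (Fin n)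
  set Λ := corr (edgeProb k (p n)) (allCopies H (Fin n)) edges
  have h2 : μ * Λ ≤ (1 + c) * ν ^ 2 := by
    have := mul_le_mul_of_nonneg_left h hμ.le
    refine this.trans (le_of_eq ?_)
    field_simp
  rcases le_or_gt c 1 with h1 | h1
  · have := mul_le_mul_of_nonneg_left h2 (sub_nonneg.2 h1)
    nlinarith [sq_nonneg ν, sq_nonneg c, mul_nonneg (sq_nonneg c) (sq_nonneg ν)]
  · have : (1 - c) * μ * Λ ≤ 0 := by
      rw [mul_assoc]
      exact mul_nonpos_of_nonpos_of_nonneg (by linarith) (by positivity)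
    exact this.trans (sq_nonneg ν)

end Asymptotic

/-! ### The lower bound -/

section Lower

open scoped Classical

variable {α : Type*} {k : ℕ} {G H : Hypergraph α} {p : ℕ → unitInterval}

/-- If `G` has a single edge, then it has no isolated vertices: otherwise that edge alone would have
no more expected copies, up to a constant, than `G`. -/
lemma eventually_eq_edgeGraph (hH : IsKGraph k H) (hGH : IsSubgraph G H)
    (heG : G.edgeSet.ncard = 1)
    (hmin : ∀ J : Hypergraph α, IsSubgraph J H → J ≠ G → 1 ≤ J.edgeSet.ncard →
      (fun n => EX k G n (p n)) =o[atTop] (fun n => EX k J n (p n))) :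
    ∀ᶠ n in atTop, 0 < (p n : ℝ) → ∃ e₀ : Set α, e₀.ncard = k ∧ G = edgeGraph e₀ := by
  obtain ⟨e₀, he₀⟩ := Set.ncard_eq_one.1 heG
  have he₀G : e₀ ∈ G.edgeSet := he₀ ▸ rfl
  have hek : e₀.ncard = k := hH.2 e₀ (hGH.2 he₀G)
  by_cases hGK : G = edgeGraph e₀
  · exact Eventually.of_forall fun n _ => ⟨e₀, hek, hGK⟩
  have hKG : IsSubgraph (edgeGraph e₀) G := ⟨edge_subset he₀G, he₀.symm.subset⟩
  have hK1 : (edgeGraph e₀).edgeSet.ncard = 1 := Set.ncard_singleton e₀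
  have hG := hH.mono hGH
  have hc : 0 < (copies (edgeGraph e₀) G).ncard := by
    rw [Set.ncard_pos ((finite_subgraphs hG.1).subset fun C hC => hC.1)]
    exact ⟨_, hKG, IsIsomorphic.refl _⟩
  set c := (copies (edgeGraph e₀) G).ncard
  have hc' : (0 : ℝ) < c := by exact_mod_cast hc
  filter_upwards [eventually_meanCopies_le hH hmin (show (0 : ℝ) < 1 / (2 * c) by positivity),
    eventually_ge_atTop (max 1 H.vertexSet.ncard)] with n hn hn1 hp
  exfalso
  have : NeZero n := ⟨by have := le_of_max_le_left hn1; omega⟩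
  have hpos : ∀ J, IsSubgraph J H → 0 < meanCopies k (p n) J (Fin n) := fun J hJ =>
    meanCopies_pos hH (le_of_max_le_right hn1) (le_of_max_le_left hn1) hp hJ
  have h1 := hn _ ((mem_subgraphs hH _).2 ⟨hKG.trans hGH, hK1.ge⟩) (Ne.symm hGK)
  have hKpos := hpos _ (hKG.trans hGH)
  have hGpos := hpos G hGH
  rw [meanCopies_eq (hG.mono hKG).2, hK1] at h1 hKpos
  rw [meanCopies_eq hG.2, heG] at h1 hGpos
  rw [pow_one] at h1 hKpos hGpos
  have hNK : 0 < (allCopies (edgeGraph e₀) (Fin n)).card := by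
    have := pos_of_mul_pos_left hKpos hp.le
    exact_mod_cast this
  have hNG : 0 < (allCopies G (Fin n)).card := by
    have := pos_of_mul_pos_left hGpos hp.le
    exact_mod_cast this
  obtain ⟨D, hD⟩ := Finset.card_pos.1 hNK
  have hcount := card_allCopies_mul G hD
  have hle : (allCopies (edgeGraph e₀) (Fin n)).card ≤ (allCopies G (Fin n)).card * c := by
    rw [← hcount]
    exact Nat.le_mul_of_pos_right _ (Nat.pos_of_mul_pos_left (hcount ▸ Nat.mul_pos hNG hc))
  have hle' : ((allCopies (edgeGraph e₀) (Fin n)).card : ℝ) * p n ≤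
      c * ((allCopies G (Fin n)).card * p n) := by
    have : ((allCopies (edgeGraph e₀) (Fin n)).card : ℝ) ≤ (allCopies G (Fin n)).card * c := by
      exact_mod_cast hle
    have := mul_le_mul_of_nonneg_right this hp.le
    linarith
  have h2 := mul_le_mul_of_nonneg_left h1 hc'.le
  have h3 : (c : ℝ) * (1 / (2 * c) * ((allCopies (edgeGraph e₀) (Fin n)).card * (p n : ℝ))) =
      (allCopies (edgeGraph e₀) (Fin n)).card * (p n : ℝ) / 2 := by
    field_simp
  rw [h3] at h2
  linarith

lemma exp_neg_le_quarter {y : ℝ} (hy : 2 ≤ y) : Real.exp (-y) ≤ 1 / 4 := by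
  have h1 : Real.exp (-y) ≤ Real.exp (-1) * Real.exp (-1) := by
    rw [← Real.exp_add, Real.exp_le_exp]; linarith
  have h2 : Real.exp (-1) ≤ 1 / 2 := by linarith [Real.exp_neg_one_lt_d9]
  calc _ ≤ _ := h1
    _ ≤ 1 / 2 * (1 / 2) := mul_le_mul h2 h2 (Real.exp_pos _).le (by norm_num)
    _ = _ := by norm_num

lemma exists_phi_near_one {b : ℝ} (hb : b < 1) :
    ∃ η : ℝ, 0 < η ∧ η < 1 ∧ ∀ x, 1 - η < x → x ≤ 1 → b ≤ phi (-x) := by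
  have hcont : Continuous fun x => phi (-x) := by
    have h := Real.continuous_mul_log.comp (continuous_const.add continuous_neg : Continuous fun x : ℝ => 1 + -x)
    exact h.sub continuous_neg
  have h1 : phi (-1) = 1 := by simp [phi]
  have h2 : ∀ᶠ x in 𝓝 (1 : ℝ), b < phi (-x) :=
    hcont.continuousAt.eventually_const_lt (by simpa only [h1] using hb)
  obtain ⟨η, hη, h⟩ := Metric.eventually_nhds_iff.1 h2
  refine ⟨min η (1 / 2), by positivity, by linarith [min_le_right η (1 / 2)], fun x hx hx1 => ?_⟩
  refine (h ?_).le
  rw [Real.dist_eq, abs_lt]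
  have := min_le_left η (1 / 2)
  constructor <;> linarith

set_option maxHeartbeats 1000000 in
/-- In the range `ε < 1 - η`, the lower bound comes from a change of measure with density
proportional to `exp (-t X_G)`. The three cases are the three ways to bound the tilted probability
of the lower tail event from below. -/
lemma eventually_le_lowerTail_of_le (hk : 0 < k) (hH : IsKGraph k H) (hGH : IsSubgraph G H)
    (heG : 1 ≤ G.edgeSet.ncard) (hunique : copies G H = {G})
    (hp : Tendsto (fun n => (p n : ℝ)) atTop (𝓝 0))
    (hmin : ∀ J : Hypergraph α, IsSubgraph J H → J ≠ G → 1 ≤ J.edgeSet.ncard →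
      (fun n => EX k G n (p n)) =o[atTop] (fun n => EX k J n (p n)))
    {ε : ℕ → ℝ} (hε : ∀ n, ε n ∈ Set.Ioc (0 : ℝ) 1)
    (hlarge : ∃ ω : ℕ → ℝ, Tendsto ω atTop atTop ∧ ∀ᶠ n in atTop,
      ind (ε n < 1) *
          (ω n * (1 + ind (G ≠ H ∧ 2 ≤ G.edgeSet.ncard) * Real.log (1 / ε n)))
        ≤ ε n ^ 2 * EX k G n (p n)) {c : ℝ} (hc : 0 < c) {η : ℝ} (hη : 0 < η) (hη1 : η < 1) :
    ∀ᶠ n in atTop, 0 < (p n : ℝ) → ε n ≤ 1 - η →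
      Real.exp (-((1 + c) * (phi (-ε n) * meanCopies k (p n) G (Fin n)))) ≤
        lowerTail k H n (p n) (ε n) := by
  obtain ⟨ω, hω, hlarge⟩ := hlarge
  have hG := hH.mono hGH
  have heH : 1 ≤ H.edgeSet.ncard :=
    heG.trans (Set.ncard_le_ncard hGH.2 (edgeSet_finite hH))
  set γ := min (η / 2) (c * η / 256) with hγdef
  have hγ : 0 < γ := by positivity
  have hγη : γ ≤ η / 2 := min_le_left _ _
  have hγc : γ ≤ c * η / 256 := min_le_right _ _
  have hγ1 : γ ≤ 1 := by linarith
  set d := γ ^ 2 * η ^ 2 / 800 with hd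
  have hd0 : 0 < d := by positivity
  set K := H.edgeSet.ncard * ∑ J ∈ subgraphs hH, ((copies J G).ncard : ℝ) with hK
  have hK0 : 0 ≤ K := mul_nonneg (Nat.cast_nonneg _) (Finset.sum_nonneg fun _ _ => Nat.cast_nonneg _)
  set κ := min (γ ^ 2 / 8) (c / 16) with hκdef
  have hκ : 0 < κ := by positivity
  set M := max 2 (Real.log (4 / γ)) with hM
  have hM2 : 2 ≤ M := le_max_left _ _
  have hsmall : ∀ x : ℝ, 0 < x → ∀ᶠ n in atTop, (p n : ℝ) ≤ x := fun x hx =>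
    (hp.eventually_lt_const hx).mono fun n hn => hn.le
  have hedge : ∀ᶠ n in atTop, 0 < (p n : ℝ) → G.edgeSet.ncard = 1 →
      ∃ e₀ : Set α, e₀.ncard = k ∧ G = edgeGraph e₀ := by
    by_cases h1 : G.edgeSet.ncard = 1
    · exact (eventually_eq_edgeGraph hH hGH h1 hmin).mono fun n hn hp _ => hn hp
    · exact Eventually.of_forall fun n _ h => absurd h h1
  filter_upwards [eventually_corr_le hH hGH heG hunique hmin (IsSubgraph.refl G) hGH hd0,
    eventually_corr_le hH hGH heG hunique hmin hGH (IsSubgraph.refl H) one_pos,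
    eventually_meanCopies_le hH hmin one_pos, hedge,
    eventually_ge_atTop (max 1 H.vertexSet.ncard), hlarge, hω.eventually_ge_atTop (M / κ),
    hsmall (γ ^ 2 / 64) (by positivity), hsmall (c / 128) (by positivity),
    hsmall (γ * η / (16 * (K + 1))) (by positivity)] with
    n hcorrG hcorrH hle hedge hn1 hlarge hω hp1 hp2 hp3 hp hεη
  have : NeZero n := ⟨by have := le_of_max_le_left hn1; omega⟩
  have hpos : ∀ J, IsSubgraph J H → 0 < meanCopies k (p n) J (Fin n) := fun J hJ =>
    meanCopies_pos hH (le_of_max_le_right hn1) (le_of_max_le_left hn1) hp hJ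
  have hq := edgeProb_mem_Icc (β := Fin n) (k := k) (p n).2
  have hμ := hpos G hGH
  have hν := hpos H (IsSubgraph.refl H)
  have hε0 := (hε n).1
  have hε1 : ε n < 1 := by linarith
  rw [EX_eq_meanCopies] at hlarge
  set x : ℝ := (p n : ℝ)
  set e := ε n
  set μ := meanCopies k x G (Fin n) with hμdef
  have hA : ∀ C ∈ allCopies G (Fin n), (edges C).Nonempty := fun C hC => edges_nonempty heG hC
  have hAr := pr_edges_le (n := n) hG heG (p n).2
  have hΛ : corr (edgeProb k x) (allCopies G (Fin n)) edges ≤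
      (1 + d) * mean (edgeProb k x) (allCopies G (Fin n)) edges := by
    refine (hcorrG hp).trans (le_of_eq ?_)
    change (1 + d) * (μ ^ 2 / μ) = (1 + d) * μ
    rw [sq, mul_div_assoc, div_self hμ.ne', mul_one]
  obtain ⟨ha, he, ht0, ht⟩ := tilt_bounds hε0 hη hεη hγ hγη
  have herr := tilt_error_le hε0 hη hεη hγ hγη hp.le hp1 (le_refl d)
  have htp : 0 ≤ tiltParam ((1 + γ) * e) := hε0.le.trans ht0
  have hγe : γ * e ≤ e := mul_le_of_le_one_left hε0.le hγ1
  have hγ2 : γ ^ 2 ≤ γ := pow_le_of_le_one hγ.le hγ1 two_ne_zero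
  have hd1 : d ≤ 1 := by
    have : γ ^ 2 * η ^ 2 ≤ 1 := mul_le_one₀ (by linarith) (by positivity) (pow_le_one₀ hη.le hη1.le)
    linarith
  -- the size of `ε² E X_G`
  have hL : 0 ≤ Real.log (1 / e) := Real.log_nonneg (by rw [le_div_iff₀ hε0]; linarith)
  have hω' : M ≤ κ * ω n := by rw [mul_comm]; exact (div_le_iff₀ hκ).1 hω
  have hm : M * (1 + ind (G ≠ H ∧ 2 ≤ G.edgeSet.ncard) * Real.log (1 / e)) ≤ κ * (e ^ 2 * μ) := by
    have h1 : ind (e < 1) = 1 := ind_of_true hε1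
    rw [h1, one_mul] at hlarge
    have h2 : 0 ≤ 1 + ind (G ≠ H ∧ 2 ≤ G.edgeSet.ncard) * Real.log (1 / e) := by
      exact add_nonneg zero_le_one (mul_nonneg (ind_nonneg _) hL)
    calc _ ≤ (κ * ω n) * (1 + ind (G ≠ H ∧ 2 ≤ G.edgeSet.ncard) * Real.log (1 / e)) :=
          mul_le_mul_of_nonneg_right hω' h2
      _ ≤ _ := by
          rw [mul_assoc]; exact mul_le_mul_of_nonneg_left hlarge hκ.le
  have hm0 : 0 ≤ e ^ 2 * μ := by positivity
  have hm2 : 2 ≤ κ * (e ^ 2 * μ) := by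
    refine le_trans ?_ hm
    exact hM2.trans (le_mul_of_one_le_right (by linarith)
      (le_add_of_nonneg_right (mul_nonneg (ind_nonneg _) hL)))
  have hκ1 : κ * (e ^ 2 * μ) ≤ γ ^ 2 / 8 * (e ^ 2 * μ) :=
    mul_le_mul_of_nonneg_right (min_le_left _ _) hm0
  have hκ2 : κ * (e ^ 2 * μ) ≤ c / 16 * (e ^ 2 * μ) :=
    mul_le_mul_of_nonneg_right (min_le_right _ _) hm0
  rw [lowerTail_eq_prob]
  -- it suffices to find a lower bound `u` for the tilted probability that is not too small
  have main : ∀ u : ℝ, Real.exp (-(κ * (e ^ 2 * μ))) ≤ u / 2 →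
      (u * (expect (edgeProb k x) fun S =>
          Real.exp (-(tiltParam ((1 + γ) * e) * count (allCopies G (Fin n)) edges S))) ≤
        expect (edgeProb k x) fun S =>
          Real.exp (-(tiltParam ((1 + γ) * e) * count (allCopies G (Fin n)) edges S)) *
          ind (count (allCopies H (Fin n)) edges S ≤ (1 - e) * meanCopies k x H (Fin n))) →
      Real.exp (-((1 + c) * (phi (-e) * μ))) ≤ prob (edgeProb k x) fun S =>
        count (allCopies H (Fin n)) edges S ≤ (1 - e) * meanCopies k x H (Fin n) := by
    intro u hu hD
    exact exp_le_prob_of_tilted hq hc hε0 hη hεη hγ hγη hγc hp.le hp1 hp2 hd0.le le_rfl hAr hμ hA hΛ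
      ((Real.exp_le_exp.2 (neg_le_neg hκ1)).trans hu)
      ((Real.exp_le_exp.2 (neg_le_neg hκ2)).trans hu) hD
  have hZ : 0 < expect (edgeProb k x) fun S =>
      Real.exp (-(tiltParam ((1 + γ) * e) * count (allCopies G (Fin n)) edges S)) :=
    expect_exp_pos hq
  by_cases hGH' : G = H
  · -- the count that defines the tilt concentrates
    refine main (1 / 2) ((exp_neg_le_quarter hm2).trans (by norm_num)) ?_
    have h := tilted_lower_tail_self hq (t := tiltParam ((1 + γ) * e)) (η := γ * e) (by positivity)
      (by linarith) (by linarith) (by linarith) hAr hμ hA hd0.le hd1 hΛ herr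
    have hgm : (γ * e) ^ 2 / 8 * mean (edgeProb k x) (allCopies G (Fin n)) edges =
        γ ^ 2 / 8 * (e ^ 2 * μ) := by rw [hμdef, meanCopies]; ring
    rw [he, hgm, show 1 - (1 + γ) * e + γ * e = 1 - e by ring] at h
    rw [← hGH']
    refine le_trans (mul_le_mul_of_nonneg_right ?_ hZ.le) h
    linarith [exp_neg_le_quarter (hm2.trans hκ1)]
  by_cases hG1 : G.edgeSet.ncard = 1
  · -- the tilted measure is a binomial random hypergraph with a smaller edge probability
    obtain ⟨e₀, he₀, hGe⟩ := hedge hp hG1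
    refine main (1 / 2) ((exp_neg_le_quarter hm2).trans (by norm_num)) ?_
    have hcard : ∀ S : Finset (Set (Fin n)), weight (edgeProb k x) S ≠ 0 →
        count (allCopies G (Fin n)) edges S = S.card := by
      intro S hS
      rw [hGe, count_allCopies_edgeGraph hk he₀, Finset.filter_true_of_mem]
      intro f hf
      by_contra hfk
      exact hS (Finset.prod_eq_zero (Finset.mem_univ f) (by simp [hf, edgeProb, hfk]))
    have hqr : ∀ f : Set (Fin n), edgeProb k x f ≤ x := fun f => by
      unfold edgeProb; split_ifs
      · exact le_rfl
      · exact hp.le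
    have h := tilted_lower_tail_chebyshev (s' := allCopies H (Fin n)) (B := edges) hq
      (η := γ * e / 2) htp hcard hqr (by linarith) (fun C hC => edges_nonempty heH hC) hν
      (by positivity)
      (tilt_chebyshev_condition hε0 hη hεη hγ hγη hp.le (by linarith))
    refine le_trans (mul_le_mul_of_nonneg_right ?_ hZ.le) h
    have h1 := hcorrH hp
    change 1 / 2 ≤ 1 - _ / (γ * e / 2 * meanCopies k x H (Fin n)) ^ 2
    set ν := meanCopies k x H (Fin n)
    have h2 : corr (edgeProb k x) (allCopies H (Fin n)) edges / (γ * e / 2 * ν) ^ 2 ≤ 1 / 2 := by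
      rw [div_le_iff₀ (by positivity)]
      refine h1.trans ?_
      have h3 : 2 ≤ γ ^ 2 / 8 * (e ^ 2 * μ) := hm2.trans hκ1
      rw [mul_div_assoc', div_le_iff₀ hμ]
      linarith [mul_le_mul_of_nonneg_left h3 (sq_nonneg ν)]
    linarith
  · -- the tilted mean of `X_H` is too small for the lower tail event to be very unlikely
    have hind : ind (G ≠ H ∧ 2 ≤ G.edgeSet.ncard) = 1 := ind_of_true ⟨hGH', by omega⟩
    rw [hind, one_mul] at hm
    have hu : Real.exp (-(κ * (e ^ 2 * μ))) ≤ γ * e / 2 / 2 := by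
      have h1 : Real.log (4 / γ) + Real.log (1 / e) ≤ κ * (e ^ 2 * μ) := by
        refine le_trans ?_ hm
        have h3 : Real.log (4 / γ) ≤ M := le_max_right _ _
        have h4 := mul_le_mul_of_nonneg_right (show 1 ≤ M by linarith) hL
        linarith
      have h2 : Real.exp (-(Real.log (4 / γ) + Real.log (1 / e))) = γ * e / 2 / 2 := by
        rw [Real.exp_neg, Real.exp_add, Real.exp_log (by positivity), Real.exp_log (by positivity)]
        field_simp
        norm_num
      rw [← h2]
      exact Real.exp_le_exp.2 (neg_le_neg h1)
    refine main (γ * e / 2) hu ?_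
    have hθ : K * x ≤ γ * η / 16 := by
      calc K * x ≤ (K + 1) * (γ * η / (16 * (K + 1))) :=
            mul_le_mul (by linarith) hp3 hp.le (by positivity)
        _ = _ := by field_simp
    refine tilted_lower_tail_markov hq htp hA (fun C hC => exists_allCopies_subgraph hGH hC)
      (fun C hC => mean_filter_not_disjoint_le hp hH hGH (mem_subgraphs hH) ?_ hC) hν hε1
      (tilt_markov_condition hε0 hη hεη hγ hγη (by positivity) hθ)
    intro J hJ
    by_cases hJG : J = G
    · rw [hJG]
    · have := hle J hJ hJG
      rwa [one_mul] at this

/-- The lower bound. For `ε` close to `1`, it is the probability that there is no copy of `G`. -/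
lemma eventually_le_lowerTail (hk : 0 < k) (hH : IsKGraph k H) (hGH : IsSubgraph G H)
    (heG : 1 ≤ G.edgeSet.ncard) (hunique : copies G H = {G})
    (hp : Tendsto (fun n => (p n : ℝ)) atTop (𝓝 0))
    (hmin : ∀ J : Hypergraph α, IsSubgraph J H → J ≠ G → 1 ≤ J.edgeSet.ncard →
      (fun n => EX k G n (p n)) =o[atTop] (fun n => EX k J n (p n)))
    {ε : ℕ → ℝ} (hε : ∀ n, ε n ∈ Set.Ioc (0 : ℝ) 1)
    (hlarge : ∃ ω : ℕ → ℝ, Tendsto ω atTop atTop ∧ ∀ᶠ n in atTop,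
      ind (ε n < 1) *
          (ω n * (1 + ind (G ≠ H ∧ 2 ≤ G.edgeSet.ncard) * Real.log (1 / ε n)))
        ≤ ε n ^ 2 * EX k G n (p n)) {c : ℝ} (hc : 0 < c) :
    ∀ᶠ n in atTop, 0 < (p n : ℝ) →
      Real.exp (-((1 + c) * (phi (-ε n) * meanCopies k (p n) G (Fin n)))) ≤
        lowerTail k H n (p n) (ε n) := by
  obtain ⟨η, hη, hη1, hphi⟩ := exists_phi_near_one (b := (1 + c / 4) / (1 + c))
    (by rw [div_lt_one (by positivity)]; linarith)
  filter_upwards [eventually_le_lowerTail_of_le hk hH hGH heG hunique hp hmin hε hlarge hc hη hη1,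
    hp.eventually_lt_const (show (0 : ℝ) < min (c / 4) (1 / 2) by positivity),
    eventually_ge_atTop 1] with n hn hpn hn1 hp0
  rcases le_or_gt (ε n) (1 - η) with h | h
  · exact hn hp0 h
  · have : NeZero n := ⟨by omega⟩
    have hq := edgeProb_mem_Icc (β := Fin n) (k := k) (p n).2
    refine le_trans ?_ (prob_count_eq_zero_le_lowerTail hGH (p n) (hε n).2)
    refine le_trans (Real.exp_le_exp.2 (neg_le_neg ?_))
      (exp_le_prob_count_eq_zero hq (r := p n) ?_ (pr_edges_le (hH.mono hGH) heG (p n).2))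
    · have h1 := hphi _ h (hε n).2
      rw [div_le_iff₀ (by positivity)] at h1
      have hμ : 0 ≤ meanCopies k (p n) G (Fin n) := mean_nonneg hq
      have h2 : 1 + (p n : ℝ) ≤ (1 + c) * phi (-ε n) := by
        linarith [hpn.le.trans (min_le_left (c / 4) (1 / 2))]
      have := mul_le_mul_of_nonneg_right h2 hμ
      rw [mul_assoc] at this
      exact this
    · exact hpn.le.trans (min_le_right _ _)

end Lower

end LowerTail

end

theorem mainTheorem4 {α : Type*} (k : ℕ) (hk : 2 ≤ k) (G H : Hypergraph α)
    (hH : LowerTail.IsKGraph k H) (hGH : LowerTail.IsSubgraph G H)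
    (heG : 1 ≤ G.edgeSet.ncard)
    (hunique : ∃! C : Hypergraph α, C ∈ LowerTail.copies G H)
    (p : ℕ → unitInterval) (hp : Tendsto (fun n => (p n : ℝ)) atTop (𝓝 0))
    (hmin : ∀ J : Hypergraph α, LowerTail.IsSubgraph J H → J ≠ G → 1 ≤ J.edgeSet.ncard →
      (fun n => LowerTail.EX k G n (p n)) =o[atTop] (fun n => LowerTail.EX k J n (p n)))
    (ε : ℕ → ℝ) (hε : ∀ n, ε n ∈ Set.Ioc (0 : ℝ) 1)
    (hlarge : ∃ ω : ℕ → ℝ, Tendsto ω atTop atTop ∧ ∀ᶠ n in atTop,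
      LowerTail.ind (ε n < 1) *
          (ω n * (1 + LowerTail.ind (G ≠ H ∧ 2 ≤ G.edgeSet.ncard) * Real.log (1 / ε n)))
        ≤ ε n ^ 2 * LowerTail.EX k G n (p n)) :
    (fun n => Real.log (LowerTail.lowerTail k H n (p n) (ε n)))
      ~[atTop] (fun n => -LowerTail.phi (-ε n) * LowerTail.EX k G n (p n)) := by
  open LowerTail in
  have huniq : copies G H = {G} := by
    obtain ⟨C, -, hC⟩ := hunique
    have hGG : G ∈ copies G H := ⟨hGH, IsIsomorphic.refl G⟩
    refine Set.eq_singleton_iff_unique_mem.2 ⟨hGG, fun D hD => ?_⟩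
    rw [hC D hD, hC G hGG]
  refine isLittleO_iff.2 fun c hc => ?_
  filter_upwards [eventually_lowerTail_le hH hGH heG huniq hmin hε hc,
    eventually_le_lowerTail (by omega) hH hGH heG huniq hp hmin hε hlarge hc,
    eventually_ge_atTop 1] with n hup hlow hn1
  have : NeZero n := ⟨by omega⟩
  have hq := edgeProb_mem_Icc (β := Fin n) (k := k) (p n).2
  have hμ : 0 ≤ meanCopies k (p n) G (Fin n) := mean_nonneg hq
  have hφ := (by positivity : 0 ≤ ε n ^ 2 / 4).trans (sq_div_four_le_phi_neg (hε n))
  rw [Pi.sub_apply, EX_eq_meanCopies, Real.norm_eq_abs, Real.norm_eq_abs, neg_mul, abs_neg,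
    abs_of_nonneg (mul_nonneg hφ hμ), sub_neg_eq_add]
  rcases eq_or_lt_of_le (p n).2.1 with h0 | h0
  · -- for `p = 0` both sides vanish
    have hr := pr_edges_le (n := n) (hH.mono hGH) heG (p n).2
    have hμ0 : meanCopies k (p n) G (Fin n) = 0 :=
      le_antisymm (Finset.sum_nonpos fun C hC => (hr C hC).trans h0.ge) hμ
    have h1 : 1 ≤ lowerTail k H n (p n) (ε n) := by
      have h2 := exp_le_prob_count_eq_zero hq (by rw [← h0]; norm_num) hr
      have h3 := h2.trans (prob_count_eq_zero_le_lowerTail hGH (p n) (hε n).2)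
      change Real.exp (-((1 + (p n : ℝ)) * meanCopies k (p n) G (Fin n))) ≤ _ at h3
      rwa [hμ0, mul_zero, neg_zero, Real.exp_zero] at h3
    have h2 : lowerTail k H n (p n) (ε n) ≤ 1 := by
      have : IsProbabilityMeasure (edgeLaw k n (p n)) := by unfold edgeLaw; infer_instance
      exact measureReal_le_one
    rw [le_antisymm h2 h1, hμ0]
    simp
  · have hlow := hlow h0
    have hup := hup h0
    have hpos := (Real.exp_pos _).trans_le hlow
    have h1 := (Real.le_log_iff_exp_le hpos).2 hlow
    have h2 := (Real.log_le_iff_le_exp hpos).2 hup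
    rw [abs_le]
    constructor <;> linarith
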